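/- Let $v_2<v_1$ with either $v_2<0<v_1$ or $0<v_2<v_1$, let $\lambda,\xi>0$ and $j\in\{1,2\}$. A geometric counting process (GCP) with intensity $\lambda$ is a mixed Poisson process whose random intensity is exponentially distributed with mean $\lambda$. In the extended telegraph process $(X(t),V(t))$ with $X(0)=0$, $V(0)=v_j$, the velocity $V$ alternates between $v_1$ and $v_2$, the successive durations of the motion with velocity $v_1$, respectively $v_2$, being the successive intertimes of two independent GCPs with intensity $\lambda$, and $X(t)=\int_0^tV(s)\,ds$. The process $(\tilde X(t),V(t))$ with resets is obtained as follows: at the epochs of an independent Poisson process with intensity $\xi$ the particle is instantaneously put back at the origin and starts afresh, with velocity $v_j$, as an independent copy of the extended telegraph process. For $x\in\mathbb R$, $t>0$ write $\Gamma(a,z_0,z_1)=\int_{z_0}^{z_1}u^{a-1}e^{-u}\,du$, $\tau=\tau(x,t)=\frac{x-v_2t}{v_1-v_2}$, $M_x=\max\{\frac x{v_1},\frac x{v_2}\}$, $m_{x,t}=\min\{\frac x{v_2},t\}$, $\boldsymbol I(x,t)=\mathbb 1_{\{\min\{v_2t,0\}<x<v_1t\}}$, $$\Gamma_\lambda^\xi(x,t)=\begin{cases}\Gamma\big[0,(M_x+\frac1\lambda)\xi,(t+\frac1\lambda)\xi\big],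 & v_2<0<v_1,\\ \Gamma\big[0,(\frac x{v_1}+\frac1\lambda)\xi,(m_{x,t}+\frac1\lambda)\xi\big], & 0<v_2<v_1,\end{cases}$$ $$\Theta_\lambda^\xi(x,t)=\begin{cases}\dfrac{e^{-\xi M_x}}{1+\lambda M_x}-\dfrac{e^{-\xi t}}{1+\lambda t}, & v_2<0<v_1,\\[2ex] \dfrac{e^{-\xi x/v_1}}{1+\lambda x/v_1}-\dfrac{e^{-\xi m_{x,t}}}{1+\lambda m_{x,t}}, & 0<v_2<v_1.\end{cases}$$ (Terms multiplied by an indicator equal to $0$ are read as $0$.) Then for all $t>0$ the sub-densities $\tilde p_i(x,t\,|\,v_j)\,dx=P[\tilde X(t)\in dx,\,V(t)=v_i\,|\,\tilde X(0)=0,V(0)=v_j]$, $i=1,2$, understood as generalized densities on $\mathbb R$ (that is, a Dirac mass plus an integrable density which together give $P[\tilde X(t)\in B,V(t)=v_i\,|\,\tilde X(0)=0,V(0)=v_j]$ for every Borel set $B\subseteq\mathbb R$), are $$\begin{aligned}\tilde p_j(x,t\,|\,v_j)={}&\frac{e^{-\xi t}\,\delta(x-v_jt)}{1+\lambda t}+\mathbb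 1_{\{v_2t<x<v_1t\}}\frac{e^{-\xi t}\lambda^2\tau^{2-j}(t-\tau)^{j-1}}{(v_1-v_2)(1+\lambda t)^2}+\mathrm{sgn}(v_j)\,\mathbb 1_{\{0<\frac x{v_j}<t\}}\frac{\xi e^{-\xi x/v_j}}{v_j+\lambda x}\\&+\boldsymbol I(x,t)\Big[(-1)^{3-j}\frac{\xi(v_{3-j}+\lambda x)}{(v_1-v_2)^2}\Theta_\lambda^\xi(x,t)+(-1)^j\frac{\xi e^{\xi/\lambda}}{(v_1-v_2)^2}\Big(\frac{v_{3-j}(\lambda+\xi)}{\lambda}+x\xi\Big)\Gamma_\lambda^\xi(x,t)\Big],\end{aligned}$$ $$\begin{aligned}\tilde p_{3-j}(x,t\,|\,v_j)={}&\mathbb 1_{\{v_2t<x<v_1t\}}\frac{e^{-\xi t}\lambda\,[1+\lambda\tau^{j-1}(t-\tau)^{2-j}]}{(v_1-v_2)(1+\lambda t)^2}+\boldsymbol I(x,t)\Big[(-1)^j\frac{\xi(v_{3-j}+\lambda x)}{(v_1-v_2)^2}\Theta_\lambda^\xi(x,t)\\&+(-1)^{3-j}\frac{\xi e^{\xi/\lambda}}{(v_1-v_2)^2}\Big(\frac{v_j(\lambda+\xi)}{\lambda}+x\xi+(-1)^j\frac{\xi(v_1-v_2)}{\lambda}\Big)\Gamma_\lambda^\xi(x,t)\Big].\end{aligned}$$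 -/

import Mathlib

open MeasureTheory ProbabilityTheory

noncomputable section

namespace ResetTelegraph

/-! ### Counting processes -/

/-- The `n`-th epoch `T_n = D_1 + ⋯ + D_n` of the point process with successive intertimes
`d 0 = D_1, d 1 = D_2, …`; in particular `T_0 = 0`. -/
def epoch (d : ℕ → ℝ) (n : ℕ) : ℝ := ∑ k ∈ Finset.range n, d k

/-- The number of epochs `T_1, T_2, …` in `[0, t]`. -/
def count (d : ℕ → ℝ) (t : ℝ) : ℕ := {n : ℕ | epoch d (n + 1) ≤ t}.ncard

/-- The law of the intertimes of a Poisson process with intensity `α`: i.i.d. exponential random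
variables with rate `α`. -/
def poissonLaw (α : ℝ) : Measure (ℕ → ℝ) := Measure.infinitePi fun _ : ℕ => expMeasure α

/-- The law of the intertimes of a geometric counting process with intensity `lam`, i.e. of a mixed
Poisson process whose random intensity `A` is exponential with mean `lam`.  Conditionally on
`A = α`, the intertimes are i.i.d. exponential with rate `α`, that is, they are `E_n / α` with
`E_n` i.i.d. unit exponential random variables. -/
def geometricLaw (lam : ℝ) : Measure (ℕ → ℝ) :=
  ((expMeasure lam⁻¹).prod (poissonLaw 1)).map fun p n => p.2 n / p.1

/-! ### The telegraph process without resets -/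

/-- The velocity `v_j`, `j = 1, 2`. -/
def vel (v₁ v₂ : ℝ) (j : ℕ) : ℝ := if j = 1 then v₁ else v₂

/-- The sequence `a 0, b 0, a 1, b 1, …`. -/
def interleave (a b : ℕ → ℝ) (n : ℕ) : ℝ := if Even n then a (n / 2) else b (n / 2)

/-- The alternating counting process `N(t)` of velocity changes when the initial velocity is `v_j`;
`u` and `w` are the successive durations of the motion with velocity `v₁` and `v₂`. -/
def switches (j : ℕ) (u w : ℕ → ℝ) (t : ℝ) : ℕ :=
  count (if j = 1 then interleave u w else interleave w u) t

/-- `V(t)` for `V(0) = v_j`. -/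
def velocity (v₁ v₂ : ℝ) (j : ℕ) (u w : ℕ → ℝ) (t : ℝ) : ℝ :=
  (v₁ + v₂) / 2 + (-1) ^ (j - 1) * ((v₁ - v₂) / 2) * (-1) ^ switches j u w t

/-- `X(t) = ∫₀ᵗ V(s) ds` for `X(0) = 0`, `V(0) = v_j`. -/
def position (v₁ v₂ : ℝ) (j : ℕ) (u w : ℕ → ℝ) (t : ℝ) : ℝ :=
  ∫ s in (0 : ℝ)..t, velocity v₁ v₂ j u w s

/-! ### The telegraph process with resets

`r` is the sequence of times between consecutive resets; `u k` and `w k` are the durations of the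
motion with velocity `v₁` and `v₂` after the `k`-th reset (`k = 0`: from time `0` on). At each
reset the particle is put back at the origin and starts afresh with velocity `v_j`. -/

/-- The time elapsed at time `t` since the last reset (since `0`, if there was none). -/
def age (r : ℕ → ℝ) (t : ℝ) : ℝ := t - epoch r (count r t)

/-- The velocity at time `t` of the process with resets. -/
def resetVelocity (v₁ v₂ : ℝ) (j : ℕ) (r : ℕ → ℝ) (u w : ℕ → ℕ → ℝ) (t : ℝ) : ℝ :=
  velocity v₁ v₂ j (u (count r t)) (w (count r t)) (age r t)

/-- The position `X̃(t)` at time `t` of the process with resets. -/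
def resetPosition (v₁ v₂ : ℝ) (j : ℕ) (r : ℕ → ℝ) (u w : ℕ → ℕ → ℝ) (t : ℝ) : ℝ :=
  position v₁ v₂ j (u (count r t)) (w (count r t)) (age r t)

/-- The random elements driving the motion: the resets form a Poisson process with intensity `xi`;
for each `k` the durations `U k`, `W k` of the motion with velocity `v₁`, `v₂` after the `k`-th
reset are the intertimes of geometric counting processes with intensity `lam`; all of these
processes are mutually independent. -/
structure IsDriving {Ω : Type*} [MeasurableSpace Ω] (P : Measure Ω) (lam xi : ℝ)
    (R : Ω → ℕ → ℝ) (U W : ℕ → Ω → ℕ → ℝ) : Prop where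
  resets : HasLaw R (poissonLaw xi) P
  durations₁ : ∀ k, HasLaw (U k) (geometricLaw lam) P
  durations₂ : ∀ k, HasLaw (W k) (geometricLaw lam) P
  indep : iIndepFun (Sum.elim (fun _ : Unit => R) (Sum.elim U W)) P

/-! ### The functions in the sub-densities -/

/-- The generalized incomplete Gamma function `Γ(a, z₀, z₁)`. -/
def genGamma (a z₀ z₁ : ℝ) : ℝ := ∫ u in z₀..z₁, u ^ (a - 1) * Real.exp (-u)

/-- `τ(x, t)`. -/
def tau (v₁ v₂ x t : ℝ) : ℝ := (x - v₂ * t) / (v₁ - v₂)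

/-- `M_x`. -/
def bigM (v₁ v₂ x : ℝ) : ℝ := max (x / v₁) (x / v₂)

/-- `m_{x,t}`. -/
def smallM (v₂ x t : ℝ) : ℝ := min (x / v₂) t

/-- `Γ_λ^ξ(x, t)`: first case `v₂ < 0 < v₁`, second case `0 < v₂ < v₁`. -/
def gammaFun (v₁ v₂ lam xi x t : ℝ) : ℝ :=
  if v₂ < 0 then genGamma 0 ((bigM v₁ v₂ x + 1 / lam) * xi) ((t + 1 / lam) * xi)
  else genGamma 0 ((x / v₁ + 1 / lam) * xi) ((smallM v₂ x t + 1 / lam) * xi)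

/-- `Θ_λ^ξ(x, t)`: first case `v₂ < 0 < v₁`, second case `0 < v₂ < v₁`. -/
def thetaFun (v₁ v₂ lam xi x t : ℝ) : ℝ :=
  if v₂ < 0 then
    Real.exp (-xi * bigM v₁ v₂ x) / (1 + lam * bigM v₁ v₂ x)
      - Real.exp (-xi * t) / (1 + lam * t)
  else
    Real.exp (-xi * (x / v₁)) / (1 + lam * (x / v₁))
      - Real.exp (-xi * smallM v₂ x t) / (1 + lam * smallM v₂ x t)

open Classical in
/-- The indicator `𝟙_A` of a statement. -/
def ind (A : Prop) : ℝ := if A then 1 else 0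

/-- `I(x, t)`. -/
def bigI (v₁ v₂ x t : ℝ) : ℝ := ind (min (v₂ * t) 0 < x ∧ x < v₁ * t)

/-- The absolutely continuous part of `p̃_j(x, t | v_j)`. -/
def densitySame (v₁ v₂ lam xi : ℝ) (j : ℕ) (x t : ℝ) : ℝ :=
  ind (v₂ * t < x ∧ x < v₁ * t) *
      (Real.exp (-xi * t) * lam ^ 2 * tau v₁ v₂ x t ^ (2 - j) * (t - tau v₁ v₂ x t) ^ (j - 1)
        / ((v₁ - v₂) * (1 + lam * t) ^ 2))
    + Real.sign (vel v₁ v₂ j) * ind (0 < x / vel v₁ v₂ j ∧ x / vel v₁ v₂ j < t) *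
      (xi * Real.exp (-xi * (x / vel v₁ v₂ j)) / (vel v₁ v₂ j + lam * x))
    + bigI v₁ v₂ x t *
      ((-1) ^ (3 - j) * (xi * (vel v₁ v₂ (3 - j) + lam * x) / (v₁ - v₂) ^ 2)
          * thetaFun v₁ v₂ lam xi x t
        + (-1) ^ j * (xi * Real.exp (xi / lam) / (v₁ - v₂) ^ 2)
          * (vel v₁ v₂ (3 - j) * (lam + xi) / lam + x * xi) * gammaFun v₁ v₂ lam xi x t)

/-- `p̃_{3-j}(x, t | v_j)`. -/
def densityOther (v₁ v₂ lam xi : ℝ) (j : ℕ) (x t : ℝ) : ℝ :=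
  ind (v₂ * t < x ∧ x < v₁ * t) *
      (Real.exp (-xi * t) * lam
          * (1 + lam * tau v₁ v₂ x t ^ (j - 1) * (t - tau v₁ v₂ x t) ^ (2 - j))
        / ((v₁ - v₂) * (1 + lam * t) ^ 2))
    + bigI v₁ v₂ x t *
      ((-1) ^ j * (xi * (vel v₁ v₂ (3 - j) + lam * x) / (v₁ - v₂) ^ 2)
          * thetaFun v₁ v₂ lam xi x t
        + (-1) ^ (3 - j) * (xi * Real.exp (xi / lam) / (v₁ - v₂) ^ 2)
          * (vel v₁ v₂ j * (lam + xi) / lam + x * xi + (-1) ^ j * (xi * (v₁ - v₂) / lam))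
          * gammaFun v₁ v₂ lam xi x t)

end ResetTelegraph

end

open scoped ENNReal

namespace ResetTelegraph

/-! The proof conditions on the last reset. The age of a Poisson process at time t equals t with
probability e^{-ξt} and otherwise has density ξe^{-ξs} on (0, t) (`tsum_lintegral_age`). The
durations used since the last reset are independent of the reset times, whichever reset it is.
Hence, if G(s) is the probability of the event for the process without resets at time s, the
probability for the process with resets is e^{-ξt} G(t) + ∫₀ᵗ ξe^{-ξs} G(s) ds (`measure_reset`,
`measure_resetPosition`).

For G, let a be the initial velocity and b the other one. After 2n changes the time spent with
velocity b is the n-th epoch of one geometric process, and the event says that the other process has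
exactly n epochs in the remaining time; an odd number of changes is similar. Mixing Erlang and
Poisson laws over the exponential intensity gives the epoch density and the counting probabilities
in closed form. Their products sum over n by ∑ (n+1)qⁿ = (1-q)⁻² (`law_travel_even`,
`law_travel_odd`), and an affine change of variables turns the time spent into the displacement.

For fixed x these densities have the form (C + D(1+λs))/(1+λs)² while v₂s < x < v₁s, and vanish
otherwise. The admissible s < t form an interval. Integrating against ξe^{-ξs} by parts gives
boundary terms, which are Θ, and a remaining integral of e^{-ξs}/(1+λs), which is Γ
(`integral_exp_mul_div_sq`, `lintegral_window`). The atom of mass 1/(1+λs) at as, due to no change,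
is spread by the random age into the term with sgn(v_j); only the atom of no reset and no change
survives.

Everything up to the last step takes values in `ℝ≥0∞`, so that sums and integrals may be exchanged
freely; integrability follows at the end from finite total mass (`integrable_and_measureReal`). -/

lemma measurableSet_setOf_and {α : Type*} [MeasurableSpace α] {p q : α → Prop}
    (hp : MeasurableSet {x | p x}) (hq : MeasurableSet {x | q x}) :
    MeasurableSet {x | p x ∧ q x} := by
  have : {x | p x ∧ q x} = {x | p x} ∩ {x | q x} := by ext; simp
  rw [this]
  exact hp.inter hq

/-! ### Epochs of a Poisson process -/

/-- The Erlang density of the `(n + 1)`-st epoch of a Poisson process with intensity `r`. -/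
noncomputable def erlang (r : ℝ) (n : ℕ) (x : ℝ) : ℝ≥0∞ :=
  (Set.Ioi (0 : ℝ)).indicator
    (fun x => ENNReal.ofReal (r ^ (n + 1) * x ^ n / n.factorial * Real.exp (-(r * x)))) x

@[fun_prop]
lemma measurable_erlang (r : ℝ) (n : ℕ) : Measurable (erlang r n) := by
  unfold erlang
  exact Measurable.indicator (by fun_prop) measurableSet_Ioi

lemma erlang_of_pos {r x : ℝ} (n : ℕ) (hx : 0 < x) :
    erlang r n x =
      ENNReal.ofReal (r ^ (n + 1) * x ^ n / n.factorial * Real.exp (-(r * x))) := by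
  simp [erlang, hx]

lemma erlang_of_nonpos {r x : ℝ} (n : ℕ) (hx : x ≤ 0) : erlang r n x = 0 := by
  simp [erlang, hx]

lemma epoch_zero (d : ℕ → ℝ) : epoch d 0 = 0 := by simp [epoch]

lemma epoch_succ (d : ℕ → ℝ) (n : ℕ) : epoch d (n + 1) = epoch d n + d n := by
  simp [epoch, Finset.sum_range_succ]

@[fun_prop]
lemma measurable_epoch (n : ℕ) : Measurable fun d : ℕ → ℝ => epoch d n := by
  unfold epoch
  fun_prop

lemma isProbabilityMeasure_poissonLaw {r : ℝ} (hr : 0 < r) :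
    IsProbabilityMeasure (poissonLaw r) := by
  have := isProbabilityMeasure_expMeasure hr
  unfold poissonLaw
  infer_instance

lemma lintegral_expMeasure {r : ℝ} {f : ℝ → ℝ≥0∞} (hf : Measurable f) :
    ∫⁻ x, f x ∂expMeasure r = ∫⁻ x, erlang r 0 x * f x := by
  have hm : Measurable (gammaPDF 1 r) := (measurable_gammaPDFReal 1 r).ennreal_ofReal
  unfold expMeasure gammaMeasure
  rw [lintegral_withDensity_eq_lintegral_mul _ hm hf]
  refine lintegral_congr_ae ?_
  -- The point 0 is excluded because `erlang r 0` vanishes there, while the exponential density does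
  -- not.
  have h0 : ∀ᵐ x : ℝ, x ≠ 0 := by simp [ae_iff]
  filter_upwards [h0] with x hx
  simp only [Pi.mul_apply]
  congr 1
  rcases lt_or_gt_of_ne hx with h | h
  · rw [gammaPDF_of_neg h, erlang_of_nonpos 0 h.le]
  · rw [gammaPDF_of_nonneg h.le, erlang_of_pos 0 h]
    simp

lemma map_poissonLaw_eval {r : ℝ} (hr : 0 < r) (n : ℕ) :
    (poissonLaw r).map (fun d => d n) = expMeasure r := by
  have := isProbabilityMeasure_expMeasure hr
  exact Measure.infinitePi_map_eval (fun _ : ℕ => expMeasure r) n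

lemma iIndepFun_poissonLaw {r : ℝ} (hr : 0 < r) :
    iIndepFun (fun (n : ℕ) (d : ℕ → ℝ) => d n) (poissonLaw r) := by
  have := isProbabilityMeasure_expMeasure hr
  have := isProbabilityMeasure_poissonLaw hr
  rw [iIndepFun_iff_map_fun_eq_infinitePi_map (by fun_prop)]
  simp only [map_poissonLaw_eval hr]
  exact Measure.map_id

/-- The n-th epoch involves only `d 0, …, d (n - 1)`, so it is independent of the next intertime `d
n`. -/
lemma lintegral_epoch_prodMk {r : ℝ} (hr : 0 < r) (n : ℕ) {F : ℝ × ℝ → ℝ≥0∞}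
    (hF : Measurable F) :
    ∫⁻ d, F (epoch d n, d n) ∂poissonLaw r =
      ∫⁻ d, ∫⁻ y, F (epoch d n, y) ∂expMeasure r ∂poissonLaw r := by
  have := isProbabilityMeasure_expMeasure hr
  have := isProbabilityMeasure_poissonLaw hr
  have hi : IndepFun (fun d : ℕ → ℝ => epoch d n) (fun d => d n) (poissonLaw r) := by
    have h := (iIndepFun_poissonLaw hr).indepFun_sum_range_succ (fun i => by fun_prop) n
    convert h using 1
    ext d
    simp [epoch]
  have hmap := (indepFun_iff_map_prod_eq_prod_map_map (by fun_prop)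
    (measurable_pi_apply n).aemeasurable).1 hi
  rw [map_poissonLaw_eval hr] at hmap
  rw [← lintegral_map (f := F) (g := fun d : ℕ → ℝ => (epoch d n, d n)) hF (by fun_prop), hmap,
    lintegral_prod _ hF.aemeasurable, lintegral_map hF.lintegral_prod_right' (by fun_prop)]

/-- In the convolution the exponentials combine to e^{-rz}, which leaves the integral of xⁿ over (0,
z). -/
lemma lintegral_erlang_mul_erlang {r : ℝ} (hr : 0 < r) (n : ℕ) (z : ℝ) :
    ∫⁻ x, erlang r n x * erlang r 0 (z - x) = erlang r (n + 1) z := by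
  have hE : ∀ x, erlang r n x * erlang r 0 (z - x) = (Set.Ioo 0 z).indicator
      (fun x => ENNReal.ofReal (r ^ (n + 2) / n.factorial * Real.exp (-(r * z)) * x ^ n)) x := by
    intro x
    by_cases hx : 0 < x
    · by_cases hz : x < z
      · rw [Set.indicator_of_mem (by exact ⟨hx, hz⟩), erlang_of_pos n hx,
          erlang_of_pos 0 (sub_pos.2 hz), ← ENNReal.ofReal_mul (by positivity)]
        congr 1
        have : Real.exp (-(r * z)) = Real.exp (-(r * x)) * Real.exp (-(r * (z - x))) := by
          rw [← Real.exp_add]; ring_nf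
        rw [this]
        simp
        ring
      · rw [Set.indicator_of_notMem (by simp [hz]), erlang_of_nonpos 0 (by linarith), mul_zero]
    · rw [Set.indicator_of_notMem (by simp [hx]), erlang_of_nonpos n (by linarith), zero_mul]
  simp_rw [hE]
  rw [lintegral_indicator measurableSet_Ioo]
  rcases le_or_gt z 0 with hz | hz
  · rw [erlang_of_nonpos _ hz]; simp [hz]
  rw [erlang_of_pos _ hz, ← ofReal_integral_eq_lintegral_ofReal]
  · rw [← integral_Ioc_eq_integral_Ioo, ← intervalIntegral.integral_of_le hz.le,
      intervalIntegral.integral_const_mul, integral_pow]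
    congr 1
    rw [Nat.factorial_succ]
    push_cast
    field_simp
    simp
  · exact (Continuous.integrableOn_Icc (by fun_prop)).mono_set Set.Ioo_subset_Icc_self
  · filter_upwards [ae_restrict_mem measurableSet_Ioo] with x hx
    have := hx.1
    positivity

lemma lintegral_epoch_succ {r : ℝ} (hr : 0 < r) (n : ℕ) {f : ℝ → ℝ≥0∞} (hf : Measurable f) :
    ∫⁻ d, f (epoch d (n + 1)) ∂poissonLaw r = ∫⁻ x, erlang r n x * f x := by
  induction n generalizing f with
  | zero =>
    simp only [epoch_succ, epoch_zero, zero_add]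
    rw [← lintegral_expMeasure hf, ← map_poissonLaw_eval hr 0, lintegral_map hf (by fun_prop)]
  | succ n ih =>
    simp only [epoch_succ _ (n + 1)]
    rw [lintegral_epoch_prodMk hr (n + 1) (F := fun p => f (p.1 + p.2)) (by fun_prop)]
    have h1 : ∀ x, ∫⁻ y, f (x + y) ∂expMeasure r = ∫⁻ z, erlang r 0 (z - x) * f z := by
      intro x
      rw [lintegral_expMeasure (f := fun y => f (x + y)) (by fun_prop)]
      rw [← lintegral_add_right_eq_self (fun z => erlang r 0 (z - x) * f z) x]
      simp [add_comm x]
    simp only [h1]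
    rw [ih (f := fun x => ∫⁻ z, erlang r 0 (z - x) * f z)
      (Measurable.lintegral_prod_right' (f := fun p : ℝ × ℝ => erlang r 0 (p.2 - p.1) * f p.2)
        (by fun_prop))]
    have h2 : ∀ x, erlang r n x * ∫⁻ z, erlang r 0 (z - x) * f z =
        ∫⁻ z, erlang r n x * erlang r 0 (z - x) * f z := by
      intro x
      rw [← lintegral_const_mul _ (by fun_prop)]
      simp [mul_assoc]
    simp_rw [h2]
    rw [lintegral_lintegral_swap (by fun_prop)]
    refine lintegral_congr fun z => ?_
    rw [lintegral_mul_const _ (by fun_prop), lintegral_erlang_mul_erlang hr]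

lemma expMeasure_Ioi {r : ℝ} (hr : 0 < r) {z : ℝ} (hz : 0 ≤ z) :
    expMeasure r (Set.Ioi z) = ENNReal.ofReal (Real.exp (-(r * z))) := by
  have := isProbabilityMeasure_expMeasure hr
  have h := cdf_expMeasure_eq hr z
  rw [if_pos hz, cdf_eq_real] at h
  rw [← Set.compl_Iic, prob_compl_eq_one_sub measurableSet_Iic, ← ofReal_measureReal, h,
    ← ENNReal.ofReal_one, ← ENNReal.ofReal_sub]
  · congr 1; ring
  · have : Real.exp (-(r * z)) ≤ 1 := Real.exp_le_one_iff.2 (by nlinarith [mul_nonneg hr.le hz])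
    linarith

/-- The set of intertimes for which exactly `n` epochs lie in `[0, t]`. -/
def stay (n : ℕ) (t : ℝ) : Set (ℕ → ℝ) := {d | epoch d n ≤ t ∧ t < epoch d (n + 1)}

lemma measurableSet_stay (n : ℕ) (t : ℝ) : MeasurableSet (stay n t) :=
  measurableSet_setOf_and (measurableSet_le (by fun_prop) (by fun_prop))
    (measurableSet_lt (by fun_prop) (by fun_prop))

/-- Given that the n-th epoch is x ≤ t, the next intertime exceeds t - x with probability
e^{-r(t-x)}, independently of the past. -/
lemma lintegral_stay {r : ℝ} (hr : 0 < r) (n : ℕ) (t : ℝ) {f : ℝ → ℝ≥0∞} (hf : Measurable f) :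
    ∫⁻ d in stay n t, f (epoch d n) ∂poissonLaw r =
      ∫⁻ d, (Set.Iic t).indicator
        (fun x => ENNReal.ofReal (Real.exp (-(r * (t - x)))) * f x) (epoch d n) ∂poissonLaw r := by
  let F : ℝ × ℝ → ℝ≥0∞ := {p : ℝ × ℝ | p.1 ≤ t ∧ t < p.1 + p.2}.indicator fun p => f p.1
  have hS : MeasurableSet {p : ℝ × ℝ | p.1 ≤ t ∧ t < p.1 + p.2} :=
    measurableSet_setOf_and (measurableSet_le (by fun_prop) (by fun_prop))
      (measurableSet_lt (by fun_prop) (by fun_prop))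
  have hF : Measurable F := Measurable.indicator (by fun_prop) hS
  rw [← lintegral_indicator (measurableSet_stay n t)]
  have h1 : ∀ d, (stay n t).indicator (fun d => f (epoch d n)) d = F (epoch d n, d n) := by
    intro d
    simp only [F, Set.indicator, stay, Set.mem_ofPred_eq, epoch_succ]
  simp_rw [h1]
  rw [lintegral_epoch_prodMk hr n hF]
  refine lintegral_congr fun d => ?_
  by_cases hx : epoch d n ≤ t
  · have h2 : ∀ y, F (epoch d n, y) = (Set.Ioi (t - epoch d n)).indicator
        (fun _ => f (epoch d n)) y := by
      intro y
      simp only [F, Set.indicator, Set.mem_ofPred_eq, hx, true_and, Set.mem_Ioi, sub_lt_iff_lt_add']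
    simp_rw [h2]
    rw [lintegral_indicator measurableSet_Ioi, setLIntegral_const,
      expMeasure_Ioi hr (sub_nonneg.2 hx), Set.indicator_of_mem (by exact hx), mul_comm]
  · have h2 : ∀ y, F (epoch d n, y) = 0 := by
      intro y
      simp [F, hx]
    simp [h2, hx]

lemma lintegral_stay_zero {r : ℝ} (hr : 0 < r) {t : ℝ} (ht : 0 ≤ t) {f : ℝ → ℝ≥0∞}
    (hf : Measurable f) :
    ∫⁻ d in stay 0 t, f (epoch d 0) ∂poissonLaw r =
      ENNReal.ofReal (Real.exp (-(r * t))) * f 0 := by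
  have := isProbabilityMeasure_poissonLaw hr
  rw [lintegral_stay hr 0 t hf]
  simp [epoch_zero, ht]

/-- The factor e^{-rx} of the Erlang density and the survival probability e^{-r(t-x)} multiply to
e^{-rt}, free of x. -/
lemma lintegral_stay_succ {r : ℝ} (hr : 0 < r) (n : ℕ) (t : ℝ) {f : ℝ → ℝ≥0∞}
    (hf : Measurable f) :
    ∫⁻ d in stay (n + 1) t, f (epoch d (n + 1)) ∂poissonLaw r =
      ∫⁻ x in Set.Ioc 0 t,
        ENNReal.ofReal (r ^ (n + 1) * x ^ n / n.factorial * Real.exp (-(r * t))) * f x := by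
  rw [lintegral_stay hr (n + 1) t hf, lintegral_epoch_succ hr n
    (Measurable.indicator (by fun_prop) measurableSet_Iic), ← lintegral_indicator measurableSet_Ioc]
  refine lintegral_congr fun x => ?_
  by_cases hx : 0 < x
  · by_cases hxt : x ≤ t
    · rw [erlang_of_pos n hx, Set.indicator_of_mem (by exact hxt),
        Set.indicator_of_mem (by exact ⟨hx, hxt⟩), ← mul_assoc,
        ← ENNReal.ofReal_mul (by positivity), mul_assoc, ← Real.exp_add]
      ring_nf
    · simp [hxt]
  · rw [erlang_of_nonpos n (by linarith)]
    simp [hx]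

lemma poissonLaw_stay {r : ℝ} (hr : 0 < r) (n : ℕ) {t : ℝ} (ht : 0 ≤ t) :
    poissonLaw r (stay n t) =
      ENNReal.ofReal ((r * t) ^ n / n.factorial * Real.exp (-(r * t))) := by
  rw [← setLIntegral_one]
  cases n with
  | zero =>
    have := lintegral_stay_zero hr ht (f := fun _ => 1) measurable_const
    rw [this]
    simp
  | succ n =>
    have := lintegral_stay_succ hr n t (f := fun _ => 1) measurable_const
    rw [this]
    simp only [mul_one]
    rw [← ofReal_integral_eq_lintegral_ofReal]
    · rw [← intervalIntegral.integral_of_le ht]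
      have : ∀ x : ℝ, r ^ (n + 1) * x ^ n / n.factorial * Real.exp (-(r * t)) =
        r ^ (n + 1) / n.factorial * Real.exp (-(r * t)) * x ^ n := fun x => by ring
      simp_rw [this]
      rw [intervalIntegral.integral_const_mul, integral_pow, Nat.factorial_succ]
      congr 1
      push_cast
      field_simp
      simp [mul_pow]
    · exact (Continuous.integrableOn_Icc (by fun_prop)).mono_set Set.Ioc_subset_Icc_self
    · filter_upwards [ae_restrict_mem measurableSet_Ioc] with x hx
      have := hx.1
      positivity

/-! ### Regular intertimes -/

/-- The intertimes are positive and the epochs do not accumulate. -/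
def Regular (d : ℕ → ℝ) : Prop := (∀ n, 0 < d n) ∧ ∀ t, ∃ n, t < epoch d n

lemma measurableSet_regular : MeasurableSet {d | Regular d} := by
  have : {d | Regular d} = (⋂ n, {d : ℕ → ℝ | 0 < d n}) ∩
      ⋂ m : ℕ, ⋃ n, {d : ℕ → ℝ | (m : ℝ) < epoch d n} := by
    ext d
    simp only [Regular, Set.mem_ofPred_eq, Set.mem_inter_iff, Set.mem_iInter, Set.mem_iUnion]
    refine and_congr_right fun _ => ⟨fun h m => h m, fun h t => ?_⟩
    obtain ⟨m, hm⟩ := exists_nat_ge t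
    obtain ⟨n, hn⟩ := h m
    exact ⟨n, hm.trans_lt hn⟩
  rw [this]
  refine MeasurableSet.inter (.iInter fun n => measurableSet_lt (by fun_prop) (by fun_prop))
    (.iInter fun m => .iUnion fun n => measurableSet_lt (by fun_prop) (by fun_prop))

lemma tsum_poissonLaw_stay {r : ℝ} (hr : 0 < r) {t : ℝ} (ht : 0 ≤ t) :
    ∑' n, poissonLaw r (stay n t) = 1 := by
  simp_rw [poissonLaw_stay hr _ ht]
  have hs := (NormedSpace.expSeries_div_hasSum_exp (r * t)).mul_right (Real.exp (-(r * t)))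
  rw [← Real.exp_eq_exp_ℝ, ← Real.exp_add, add_neg_cancel, Real.exp_zero] at hs
  rw [← ENNReal.ofReal_tsum_of_nonneg (fun n => by positivity) hs.summable, hs.tsum_eq,
    ENNReal.ofReal_one]

lemma ae_pos_poissonLaw {r : ℝ} (hr : 0 < r) : ∀ᵐ d ∂poissonLaw r, ∀ n, 0 < d n := by
  have := isProbabilityMeasure_expMeasure hr
  rw [ae_all_iff]
  intro n
  have h : ∀ᵐ x ∂expMeasure r, x ∈ Set.Ioi 0 := by
    rw [← Filter.eventually_mem_set.symm, mem_ae_iff_prob_eq_one measurableSet_Ioi,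
      expMeasure_Ioi hr le_rfl]
    simp
  rw [← map_poissonLaw_eval hr n] at h
  exact ae_of_ae_map (measurable_pi_apply n).aemeasurable h

lemma epoch_mono {d : ℕ → ℝ} (hd : ∀ n, 0 < d n) : Monotone (epoch d) :=
  monotone_nat_of_le_succ fun n => by rw [epoch_succ]; linarith [hd n]

lemma epoch_nonneg {d : ℕ → ℝ} (hd : ∀ n, 0 < d n) (n : ℕ) : 0 ≤ epoch d n := by
  simpa [epoch_zero] using epoch_mono hd (Nat.zero_le n)

lemma eq_of_mem_stay {d : ℕ → ℝ} (hd : ∀ n, 0 < d n) {m n : ℕ} {t : ℝ} (hm : d ∈ stay m t)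
    (hn : d ∈ stay n t) : m = n := by
  simp only [stay, Set.mem_ofPred_eq] at hm hn
  by_contra h
  rcases lt_or_gt_of_ne h with h | h
  · linarith [epoch_mono hd (Nat.succ_le_of_lt h)]
  · linarith [epoch_mono hd (Nat.succ_le_of_lt h)]

/-- The Poisson probabilities of exactly n epochs up to an integer time m sum to 1, so almost surely
the count at every integer time is finite and the epochs do not accumulate. -/
lemma ae_regular_poissonLaw {r : ℝ} (hr : 0 < r) : ∀ᵐ d ∂poissonLaw r, Regular d := by
  have := isProbabilityMeasure_poissonLaw hr
  have h (m : ℕ) : ∀ᵐ d ∂poissonLaw r, d ∈ ⋃ n, stay n (m : ℝ) := by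
    rw [← Filter.eventually_mem_set.symm,
      mem_ae_iff_prob_eq_one (.iUnion fun n => measurableSet_stay n _),
      measure_iUnion₀ _ fun n => (measurableSet_stay n _).nullMeasurableSet,
      tsum_poissonLaw_stay hr m.cast_nonneg]
    intro i j hij
    refine measure_mono_null (fun d hd => ?_) (ae_iff.1 (ae_pos_poissonLaw hr))
    exact fun hpos => hij (eq_of_mem_stay hpos hd.1 hd.2)
  filter_upwards [ae_pos_poissonLaw hr, ae_all_iff.2 h] with d hd hs
  refine ⟨hd, fun t => ?_⟩
  obtain ⟨m, hm⟩ := exists_nat_ge t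
  obtain ⟨n, hn⟩ := Set.mem_iUnion.1 (hs m)
  exact ⟨n + 1, hm.trans_lt hn.2⟩

lemma Regular.exists_mem_stay {d : ℕ → ℝ} (hd : Regular d) {t : ℝ} (ht : 0 ≤ t) :
    ∃ n, d ∈ stay n t := by
  classical
  obtain ⟨n, hn⟩ : ∃ n, t < epoch d n ∧ ∀ m < n, ¬ t < epoch d m :=
    ⟨Nat.find (hd.2 t), Nat.find_spec (hd.2 t), fun m => Nat.find_min (hd.2 t)⟩
  cases n with
  | zero => rw [epoch_zero] at hn; linarith
  | succ n => exact ⟨n, not_lt.1 (hn.2 n n.lt_succ_self), hn.1⟩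

lemma count_eq_of_mem_stay {d : ℕ → ℝ} (hd : ∀ n, 0 < d n) {n : ℕ} {t : ℝ}
    (h : d ∈ stay n t) : count d t = n := by
  have hs : {m : ℕ | epoch d (m + 1) ≤ t} = Set.Iio n := by
    ext m
    simp only [Set.mem_ofPred_eq, Set.mem_Iio]
    refine ⟨fun hm => ?_, fun hm => (epoch_mono hd (Nat.succ_le_of_lt hm)).trans h.1⟩
    by_contra hmn
    linarith [epoch_mono hd (Nat.succ_le_succ (not_lt.1 hmn)), h.2]
  rw [count, hs, Set.ncard_eq_toFinset_card']
  simp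

/-- Regularity matters here: `ncard` is 0 on infinite sets, so accumulating epochs would be counted
as none. -/
lemma Regular.count_eq_iff {d : ℕ → ℝ} (hd : Regular d) {t : ℝ} (ht : 0 ≤ t) {n : ℕ} :
    count d t = n ↔ d ∈ stay n t := by
  obtain ⟨m, hm⟩ := hd.exists_mem_stay ht
  refine ⟨fun h => ?_, count_eq_of_mem_stay hd.1⟩
  rwa [← h, count_eq_of_mem_stay hd.1 hm]

/-- The number of epochs is jointly measurable in the intertimes and the time. -/
@[fun_prop]
lemma measurable_count : Measurable fun p : (ℕ → ℝ) × ℝ => count p.1 p.2 := by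
  have h1 : ∀ p : (ℕ → ℝ) × ℝ, (count p.1 p.2 : ℝ) =
      (∑' n : ℕ, {p : (ℕ → ℝ) × ℝ | epoch p.1 (n + 1) ≤ p.2}.indicator
        (fun _ => (1 : ℝ≥0∞)) p).toReal := by
    intro p
    have h2 := ENNReal.tsum_set_one {n : ℕ | epoch p.1 (n + 1) ≤ p.2}
    rw [tsum_subtype _ (fun _ => (1 : ℝ≥0∞))] at h2
    have h3 : ∀ n : ℕ, {p : (ℕ → ℝ) × ℝ | epoch p.1 (n + 1) ≤ p.2}.indicator
        (fun _ => (1 : ℝ≥0∞)) p =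
        {n : ℕ | epoch p.1 (n + 1) ≤ p.2}.indicator (fun _ => (1 : ℝ≥0∞)) n := by
      intro n
      simp [Set.indicator]
    simp_rw [h3]
    rw [h2, count, Set.ncard]
    -- For an infinite set the sum is ∞, and `toReal` sends it to 0, which is also the value of
    -- `ncard`.
    generalize Set.encard _ = e
    cases e <;> simp
  have h2 : Measurable fun p : (ℕ → ℝ) × ℝ => (count p.1 p.2 : ℝ) := by
    simp_rw [h1]
    refine Measurable.ennreal_toReal (Measurable.tsum fun n => ?_)
    exact measurable_const.indicator (measurableSet_le (by fun_prop) (by fun_prop))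
  refine measurable_to_countable' fun n => ?_
  convert h2 (measurableSet_singleton (n : ℝ)) using 1
  ext p
  simp

lemma setLIntegral_age_count {r : ℝ} (hr : 0 < r) {t : ℝ} (ht : 0 ≤ t) (n : ℕ)
    {f : ℝ → ℝ≥0∞} :
    ∫⁻ d in {d | count d t = n}, f (age d t) ∂poissonLaw r =
      ∫⁻ d in stay n t, f (t - epoch d n) ∂poissonLaw r := by
  have h : {d | count d t = n} =ᵐ[poissonLaw r] stay n t := by
    filter_upwards [ae_regular_poissonLaw hr] with d hd
    exact propext (hd.count_eq_iff ht)
  rw [setLIntegral_congr h]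
  refine setLIntegral_congr_fun_ae (measurableSet_stay n t) ?_
  filter_upwards [ae_pos_poissonLaw hr] with d hd hs
  rw [age, count_eq_of_mem_stay hd hs]

/-- The law of the age at time `t` of a Poisson process. -/
lemma tsum_lintegral_age {r : ℝ} (hr : 0 < r) {t : ℝ} (ht : 0 ≤ t) {f : ℝ → ℝ≥0∞}
    (hf : Measurable f) :
    ∑' n, ∫⁻ d in {d | count d t = n}, f (age d t) ∂poissonLaw r =
      ENNReal.ofReal (Real.exp (-(r * t))) * f t +
        ∫⁻ s in Set.Ioo 0 t, ENNReal.ofReal (r * Real.exp (-(r * s))) * f s := by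
  simp_rw [setLIntegral_age_count hr ht]
  -- The term n = 0, no epoch in [0, t], has age t and gives the atom; the other terms add up to the
  -- density.
  rw [tsum_eq_zero_add' ENNReal.summable,
    lintegral_stay_zero hr ht (f := fun x => f (t - x)) (by fun_prop), sub_zero]
  congr 1
  have h1 : ∀ n, ∫⁻ d in stay (n + 1) t, f (t - epoch d (n + 1)) ∂poissonLaw r = _ :=
    fun n => lintegral_stay_succ hr n t (f := fun x => f (t - x)) (by fun_prop)
  simp_rw [h1]
  rw [← lintegral_tsum (fun n => by fun_prop)]
  have h2 : ∀ x ∈ Set.Ioc 0 t, ∑' n : ℕ, ENNReal.ofReal (r ^ (n + 1) * x ^ n / n.factorial *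
      Real.exp (-(r * t))) * f (t - x) =
      ENNReal.ofReal (r * Real.exp (-(r * (t - x)))) * f (t - x) := by
    intro x hx
    have hx0 := hx.1
    have hs := ((NormedSpace.expSeries_div_hasSum_exp (r * x)).mul_right
      (Real.exp (-(r * t)))).mul_left r
    rw [← Real.exp_eq_exp_ℝ, ← Real.exp_add] at hs
    have h3 : ∀ n : ℕ, r ^ (n + 1) * x ^ n / n.factorial * Real.exp (-(r * t)) =
        r * ((r * x) ^ n / n.factorial * Real.exp (-(r * t))) := fun n => by ring
    simp_rw [h3]
    rw [ENNReal.tsum_mul_right,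
      ← ENNReal.ofReal_tsum_of_nonneg (fun n => by positivity) hs.summable, hs.tsum_eq]
    ring_nf
  -- The last epoch x is replaced by the age t - x; the reflection exchanges `Ioc` and `Ico`.
  rw [setLIntegral_congr_fun measurableSet_Ioc h2, ← lintegral_indicator measurableSet_Ioc,
    setLIntegral_congr Ioo_ae_eq_Ico, ← lintegral_indicator measurableSet_Ico,
    ← lintegral_sub_left_eq_self _ t]
  refine lintegral_congr fun x => ?_
  simp only [Set.indicator, Set.mem_Ioc, Set.mem_Ico, sub_sub_cancel]
  congr 1
  simp only [eq_iff_iff]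
  constructor <;> rintro ⟨h, h'⟩ <;> constructor <;> linarith

/-! ### Epochs of a geometric counting process -/

lemma map_expMeasure_one_div {r : ℝ} (hr : 0 < r) :
    (expMeasure 1).map (fun x => x / r) = expMeasure r := by
  have := isProbabilityMeasure_expMeasure hr
  have := isProbabilityMeasure_expMeasure one_pos
  have : IsProbabilityMeasure ((expMeasure 1).map fun x => x / r) :=
    Measure.isProbabilityMeasure_map (by fun_prop)
  refine Measure.eq_of_cdf _ _ (StieltjesFunction.ext fun x => ?_)
  rw [cdf_eq_real, map_measureReal_apply (by fun_prop) measurableSet_Iic]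
  have h : (fun x : ℝ => x / r) ⁻¹' Set.Iic x = Set.Iic (x * r) := by
    ext y
    simp [div_le_iff₀ hr]
  rw [h, ← cdf_eq_real, cdf_expMeasure_eq one_pos, cdf_expMeasure_eq hr]
  simp only [mul_nonneg_iff_of_pos_right hr]
  ring_nf

lemma map_poissonLaw_one_div {r : ℝ} (hr : 0 < r) :
    (poissonLaw 1).map (fun d n => d n / r) = poissonLaw r := by
  have := isProbabilityMeasure_expMeasure one_pos
  unfold poissonLaw
  rw [Measure.infinitePi_map_pi (f := fun _ x => x / r) (fun _ : ℕ => expMeasure 1)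
    (fun _ => by fun_prop)]
  simp_rw [map_expMeasure_one_div hr]

/-- Dividing unit exponentials by r gives a Poisson process of rate r, so the geometric law is the
exponential mixture of Poisson laws. The inner integral is supplied as a separate measurable `g`,
needed only at positive rates. -/
lemma lintegral_geometricLaw {lam : ℝ} (hlam : 0 < lam) {f : (ℕ → ℝ) → ℝ≥0∞}
    (hf : Measurable f) {g : ℝ → ℝ≥0∞} (hg : Measurable g)
    (hfg : ∀ r, 0 < r → ∫⁻ d, f d ∂poissonLaw r = g r) :
    ∫⁻ d, f d ∂geometricLaw lam = ∫⁻ r, erlang lam⁻¹ 0 r * g r := by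
  have := isProbabilityMeasure_poissonLaw one_pos
  have hl : 0 < lam⁻¹ := inv_pos.2 hlam
  have := isProbabilityMeasure_expMeasure hl
  have hm : Measurable fun p : ℝ × (ℕ → ℝ) => fun n => p.2 n / p.1 := by fun_prop
  rw [geometricLaw, lintegral_map hf hm, lintegral_prod _ (by fun_prop), ← lintegral_expMeasure hg]
  have h : ∀ᵐ r ∂expMeasure lam⁻¹, r ∈ Set.Ioi 0 := by
    rw [← Filter.eventually_mem_set.symm, mem_ae_iff_prob_eq_one measurableSet_Ioi,
      expMeasure_Ioi hl le_rfl]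
    simp
  refine lintegral_congr_ae ?_
  filter_upwards [h] with r hr
  rw [← hfg r hr, ← map_poissonLaw_one_div hr, lintegral_map hf (by fun_prop)]

lemma isProbabilityMeasure_geometricLaw {lam : ℝ} (hlam : 0 < lam) :
    IsProbabilityMeasure (geometricLaw lam) := by
  have := isProbabilityMeasure_poissonLaw one_pos
  have := isProbabilityMeasure_expMeasure (inv_pos.2 hlam)
  unfold geometricLaw
  exact Measure.isProbabilityMeasure_map (by fun_prop)

lemma lintegral_erlang {r : ℝ} (hr : 0 < r) (n : ℕ) : ∫⁻ x, erlang r n x = 1 := by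
  have := isProbabilityMeasure_poissonLaw hr
  have h := lintegral_epoch_succ hr n (f := fun _ => 1) measurable_const
  simpa using h.symm

/-- The integrand is a multiple of the Erlang density of rate l + z, whose total mass is 1. This is
the integral over the random intensity. -/
lemma lintegral_erlang_mul_pow_mul_exp {l z : ℝ} (hl : 0 < l) (hz : 0 ≤ z) (k : ℕ) :
    ∫⁻ r, erlang l 0 r * ENNReal.ofReal (r ^ k * Real.exp (-(r * z))) =
      ENNReal.ofReal (l * k.factorial / (l + z) ^ (k + 1)) := by
  have h : ∀ r, erlang l 0 r * ENNReal.ofReal (r ^ k * Real.exp (-(r * z))) =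
      ENNReal.ofReal (l * k.factorial / (l + z) ^ (k + 1)) * erlang (l + z) k r := by
    intro r
    rcases le_or_gt r 0 with hr | hr
    · simp [erlang_of_nonpos _ hr]
    · have h1 : Real.exp (-((l + z) * r)) = Real.exp (-(l * r)) * Real.exp (-(r * z)) := by
        rw [← Real.exp_add]; ring_nf
      rw [erlang_of_pos _ hr, erlang_of_pos _ hr, ← ENNReal.ofReal_mul (by positivity),
        ← ENNReal.ofReal_mul (by positivity), h1]
      congr 1
      have : l + z ≠ 0 := by positivity
      field_simp
      simp
  simp_rw [h]
  rw [lintegral_const_mul _ (by fun_prop), lintegral_erlang (by positivity), mul_one]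

/-- The density of the `(n + 1)`-st epoch of a geometric counting process. -/
noncomputable def epochDensity (lam : ℝ) (n : ℕ) (y : ℝ) : ℝ :=
  (n + 1) * lam ^ (n + 1) * y ^ n / (1 + lam * y) ^ (n + 2)

/-- The probability that a geometric counting process has `n` epochs in `[0, z]`. -/
noncomputable def countProb (lam : ℝ) (n : ℕ) (z : ℝ) : ℝ :=
  (lam * z) ^ n / (1 + lam * z) ^ (n + 1)

@[fun_prop]
lemma measurable_epochDensity (lam : ℝ) (n : ℕ) : Measurable (epochDensity lam n) := by
  unfold epochDensity
  fun_prop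

@[fun_prop]
lemma measurable_countProb (lam : ℝ) (n : ℕ) : Measurable (countProb lam n) := by
  unfold countProb
  fun_prop

lemma measurable_erlang_prod (n : ℕ) : Measurable fun p : ℝ × ℝ => erlang p.1 n p.2 := by
  have : (fun p : ℝ × ℝ => erlang p.1 n p.2) = {p : ℝ × ℝ | 0 < p.2}.indicator
      fun p => ENNReal.ofReal
        (p.1 ^ (n + 1) * p.2 ^ n / n.factorial * Real.exp (-(p.1 * p.2))) := by
    ext p
    simp [erlang, Set.indicator]
  rw [this]
  exact Measurable.indicator (by fun_prop) (measurableSet_lt (by fun_prop) (by fun_prop))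

lemma lintegral_epoch_succ_geometricLaw {lam : ℝ} (hlam : 0 < lam) (n : ℕ) {f : ℝ → ℝ≥0∞}
    (hf : Measurable f) :
    ∫⁻ d, f (epoch d (n + 1)) ∂geometricLaw lam =
      ∫⁻ y in Set.Ioi 0, ENNReal.ofReal (epochDensity lam n y) * f y := by
  have hE := measurable_erlang_prod n
  have hm : Measurable fun p : ℝ × ℝ => erlang p.1 n p.2 * f p.2 := by fun_prop
  rw [lintegral_geometricLaw hlam (f := fun d => f (epoch d (n + 1))) (by fun_prop)
    hm.lintegral_prod_right' (fun r hr => lintegral_epoch_succ hr n hf)]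
  have h1 : ∀ r, erlang lam⁻¹ 0 r * ∫⁻ y, erlang r n y * f y =
      ∫⁻ y, erlang lam⁻¹ 0 r * erlang r n y * f y := by
    intro r
    rw [← lintegral_const_mul _ (by fun_prop)]
    simp [mul_assoc]
  simp only [h1]
  rw [lintegral_lintegral_swap (by fun_prop), ← lintegral_indicator measurableSet_Ioi]
  refine lintegral_congr fun y => ?_
  rw [lintegral_mul_const _ (by fun_prop)]
  rcases le_or_gt y 0 with hy | hy
  · simp [erlang_of_nonpos _ hy, hy]
  · rw [Set.indicator_of_mem (by exact hy)]
    congr 1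
    have h2 : ∀ r, erlang lam⁻¹ 0 r * erlang r n y = ENNReal.ofReal (y ^ n / n.factorial) *
        (erlang lam⁻¹ 0 r * ENNReal.ofReal (r ^ (n + 1) * Real.exp (-(r * y)))) := by
      intro r
      rw [erlang_of_pos n hy, mul_left_comm, ← ENNReal.ofReal_mul (by positivity)]
      ring_nf
    simp_rw [h2]
    rw [lintegral_const_mul _ (by fun_prop),
      lintegral_erlang_mul_pow_mul_exp (inv_pos.2 hlam) hy.le, ← ENNReal.ofReal_mul (by positivity),
      epochDensity, Nat.factorial_succ]
    congr 1
    have h3 : lam⁻¹ + y = (1 + lam * y) / lam := by field_simp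
    have : 1 + lam * y ≠ 0 := by positivity
    rw [h3, div_pow]
    push_cast
    field_simp
    ring

lemma ae_regular_geometricLaw {lam : ℝ} (hlam : 0 < lam) :
    ∀ᵐ d ∂geometricLaw lam, Regular d := by
  have hS : MeasurableSet {d | ¬ Regular d} := measurableSet_regular.compl
  rw [ae_iff, ← setLIntegral_one,
    ← lintegral_indicator hS,
    lintegral_geometricLaw hlam (g := fun _ => 0) ?_ (by fun_prop)]
  · simp
  · intro r hr
    rw [lintegral_indicator hS, setLIntegral_one]
    exact ae_iff.1 (ae_regular_poissonLaw hr)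
  · exact measurable_const.indicator hS

/-- Negative z must be covered, since z will be the time left after an epoch that may exceed the
horizon. -/
lemma geometricLaw_stay {lam : ℝ} (hlam : 0 < lam) (n : ℕ) (z : ℝ) :
    geometricLaw lam (stay n z) =
      (Set.Ici 0).indicator (fun z => ENNReal.ofReal (countProb lam n z)) z := by
  rcases lt_or_ge z 0 with hz | hz
  · rw [Set.indicator_of_notMem (by simpa using hz)]
    refine measure_mono_null (fun d hd => ?_) (ae_iff.1 (ae_regular_geometricLaw hlam))
    exact fun h => absurd hd.1 (by linarith [epoch_nonneg h.1 n])
  rw [Set.indicator_of_mem (by exact hz), ← setLIntegral_one,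
    ← lintegral_indicator (measurableSet_stay n z),
    lintegral_geometricLaw hlam (measurable_const.indicator (measurableSet_stay n z))
      (g := fun r => ENNReal.ofReal (z ^ n / n.factorial) *
        ENNReal.ofReal (r ^ n * Real.exp (-(r * z)))) (by fun_prop) ?_]
  · simp_rw [mul_left_comm]
    rw [lintegral_const_mul _ (by fun_prop),
      lintegral_erlang_mul_pow_mul_exp (inv_pos.2 hlam) hz, ← ENNReal.ofReal_mul (by positivity),
      countProb]
    congr 1
    have h3 : lam⁻¹ + z = (1 + lam * z) / lam := by field_simp
    have : 1 + lam * z ≠ 0 := by positivity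
    rw [h3, div_pow, mul_pow]
    field_simp
    ring
  · intro r hr
    rw [lintegral_indicator (measurableSet_stay n z), setLIntegral_one, poissonLaw_stay hr n hz,
      ← ENNReal.ofReal_mul (by positivity)]
    ring_nf

lemma hasSum_succ_mul_div_pow {x y : ℝ} (hx : 0 ≤ x) (hxy : x < y) :
    HasSum (fun n : ℕ => (n + 1) * x ^ n / y ^ (n + 2)) (1 / (y - x) ^ 2) := by
  have hy : 0 < y := hx.trans_lt hxy
  have hq : ‖x / y‖ < 1 := by
    rw [Real.norm_of_nonneg (by positivity), div_lt_one hy]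
    exact hxy
  have h := (hasSum_choose_mul_geometric_of_norm_lt_one 1 hq).mul_left (1 / y ^ 2)
  have : y - x ≠ 0 := by linarith
  have h1 : (fun n : ℕ => 1 / y ^ 2 * (((n + 1).choose 1 : ℕ) * (x / y) ^ n)) =
      fun n : ℕ => (n + 1) * x ^ n / y ^ (n + 2) := by
    ext n
    rw [Nat.choose_one_right, div_pow]
    push_cast
    field_simp
    ring
  have h2 : 1 / y ^ 2 * (1 / (1 - x / y) ^ (1 + 1)) = 1 / (y - x) ^ 2 := by
    have : 1 - x / y = (y - x) / y := by field_simp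
    rw [this, div_pow]
    field_simp
    ring
  rwa [h1, h2] at h

/-- The closed form rests on (1+λy)(1+λz) - λy·λz = 1 + λ(y+z): after summation the denominator
depends only on the total time y + z. This sum serves an even positive number of changes, the next
one an odd number. -/
lemma tsum_epochDensity_mul_countProb_succ {lam y z : ℝ} (hlam : 0 < lam) (hy : 0 ≤ y)
    (hz : 0 ≤ z) :
    ∑' n, ENNReal.ofReal (epochDensity lam n y) * ENNReal.ofReal (countProb lam (n + 1) z) =
      ENNReal.ofReal (lam ^ 2 * z / (1 + lam * (y + z)) ^ 2) := by
  have h := (hasSum_succ_mul_div_pow (x := lam * y * (lam * z))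
    (y := (1 + lam * y) * (1 + lam * z)) (by positivity)
    (by nlinarith [mul_nonneg hlam.le hy, mul_nonneg hlam.le hz])).mul_left (lam ^ 2 * z)
  have h1 : ∀ n, ENNReal.ofReal (epochDensity lam n y) * ENNReal.ofReal (countProb lam (n + 1) z) =
      ENNReal.ofReal (lam ^ 2 * z * ((n + 1) * (lam * y * (lam * z)) ^ n /
        ((1 + lam * y) * (1 + lam * z)) ^ (n + 2))) := by
    intro n
    rw [← ENNReal.ofReal_mul (by unfold epochDensity; positivity), epochDensity, countProb]
    congr 1
    have : 1 + lam * z ≠ 0 := by positivity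
    have : 1 + lam * y ≠ 0 := by positivity
    simp only [mul_pow]
    field_simp
    ring
  simp_rw [h1]
  rw [← ENNReal.ofReal_tsum_of_nonneg (fun n => by positivity) h.summable, h.tsum_eq]
  ring_nf

lemma tsum_epochDensity_mul_countProb {lam x z : ℝ} (hlam : 0 < lam) (hx : 0 ≤ x)
    (hz : 0 ≤ z) :
    ∑' n, ENNReal.ofReal (epochDensity lam n x) * ENNReal.ofReal (countProb lam n z) =
      ENNReal.ofReal (lam * (1 + lam * z) / (1 + lam * (x + z)) ^ 2) := by
  have h := (hasSum_succ_mul_div_pow (x := lam * x * (lam * z))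
    (y := (1 + lam * x) * (1 + lam * z)) (by positivity)
    (by nlinarith [mul_nonneg hlam.le hx, mul_nonneg hlam.le hz])).mul_left
      (lam * (1 + lam * z))
  have h1 : ∀ n, ENNReal.ofReal (epochDensity lam n x) * ENNReal.ofReal (countProb lam n z) =
      ENNReal.ofReal (lam * (1 + lam * z) * ((n + 1) * (lam * x * (lam * z)) ^ n /
        ((1 + lam * x) * (1 + lam * z)) ^ (n + 2))) := by
    intro n
    rw [← ENNReal.ofReal_mul (by unfold epochDensity; positivity), epochDensity, countProb]
    congr 1
    have : 1 + lam * z ≠ 0 := by positivity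
    have : 1 + lam * x ≠ 0 := by positivity
    simp only [mul_pow]
    field_simp
    ring
  simp_rw [h1]
  rw [← ENNReal.ofReal_tsum_of_nonneg (fun n => by positivity) h.summable, h.tsum_eq]
  ring_nf

/-! ### Paths of the telegraph process -/

lemma interleave_even (p q : ℕ → ℝ) (n : ℕ) : interleave p q (2 * n) = p n := by
  simp [interleave]

lemma interleave_odd (p q : ℕ → ℝ) (n : ℕ) : interleave p q (2 * n + 1) = q n := by
  have : (2 * n + 1) / 2 = n := by omega
  simp [interleave, this]

@[fun_prop]
lemma measurable_interleave :
    Measurable fun z : (ℕ → ℝ) × (ℕ → ℝ) => interleave z.1 z.2 := by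
  refine measurable_pi_lambda _ fun n => ?_
  unfold interleave
  split_ifs <;> fun_prop

lemma epoch_interleave_even (p q : ℕ → ℝ) (n : ℕ) :
    epoch (interleave p q) (2 * n) = epoch p n + epoch q n := by
  induction n with
  | zero => simp [epoch_zero]
  | succ n ih =>
    rw [show 2 * (n + 1) = 2 * n + 1 + 1 by ring, epoch_succ, epoch_succ, ih, interleave_even,
      interleave_odd, epoch_succ, epoch_succ]
    ring

lemma epoch_interleave_odd (p q : ℕ → ℝ) (n : ℕ) :
    epoch (interleave p q) (2 * n + 1) = epoch p (n + 1) + epoch q n := by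
  rw [epoch_succ, epoch_interleave_even, interleave_even, epoch_succ]
  ring

lemma Regular.interleave {p q : ℕ → ℝ} (hp : Regular p) (hq : Regular q) :
    Regular (interleave p q) := by
  constructor
  · intro n
    unfold ResetTelegraph.interleave
    split_ifs
    · exact hp.1 _
    · exact hq.1 _
  · intro t
    obtain ⟨n, hn⟩ := hp.2 t
    exact ⟨2 * n, by rw [epoch_interleave_even]; linarith [epoch_nonneg hq.1 n]⟩

/-- The velocity after `n` changes, if it alternates between `a` and `b`, starting with `a`. -/
noncomputable def alternate (a b : ℝ) (n : ℕ) : ℝ := if Even n then a else b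

lemma alternate_even (a b : ℝ) (n : ℕ) : alternate a b (2 * n) = a := by simp [alternate]

lemma alternate_odd (a b : ℝ) (n : ℕ) : alternate a b (2 * n + 1) = b := by simp [alternate]

/-- The displacement in `[0, s]` if the velocity alternates between `a` and `b`, starting with `a`,
and changes at the epochs of `d`. -/
noncomputable def travel (a b : ℝ) (d : ℕ → ℝ) (s : ℝ) : ℝ :=
  ∫ x in (0 : ℝ)..s, alternate a b (count d x)

@[fun_prop]
lemma measurable_alternate (a b : ℝ) : Measurable (alternate a b) := measurable_from_nat

lemma measurable_alternate_count {α : Type*} [MeasurableSpace α] (a b : ℝ) {f : α → ℕ → ℝ}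
    {g : α → ℝ} (hf : Measurable f) (hg : Measurable g) :
    Measurable fun x => alternate a b (count (f x) (g x)) := by
  have h := measurable_count.comp (hf.prodMk hg)
  exact (measurable_alternate a b).comp h

lemma measurable_travel (a b : ℝ) :
    Measurable fun p : (ℕ → ℝ) × ℝ => travel a b p.1 p.2 := by
  have hg : Measurable fun z : ((ℕ → ℝ) × ℝ) × ℝ => alternate a b (count z.1.1 z.2) :=
    measurable_alternate_count a b (by fun_prop) (by fun_prop)
  -- An interval integral is a difference of two integrals over `Ioc`, each a parametric integral of
  -- a jointly measurable function.
  have h : ∀ u v : (ℕ → ℝ) × ℝ → ℝ, Measurable u → Measurable v →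
      Measurable fun p : (ℕ → ℝ) × ℝ =>
        ∫ x in Set.Ioc (u p) (v p), alternate a b (count p.1 x) := by
    intro u v hu hv
    have hS : MeasurableSet {z : ((ℕ → ℝ) × ℝ) × ℝ | u z.1 < z.2 ∧ z.2 ≤ v z.1} :=
      measurableSet_setOf_and (measurableSet_lt (by fun_prop) (by fun_prop))
        (measurableSet_le (by fun_prop) (by fun_prop))
    have h1 := (hg.indicator hS).stronglyMeasurable.integral_prod_right' (ν := volume)
    convert h1.measurable using 2 with p
    rw [← integral_indicator measurableSet_Ioc]
    rfl
  unfold travel intervalIntegral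
  exact (h _ _ measurable_const measurable_snd).sub (h _ _ measurable_snd measurable_const)

lemma intervalIntegrable_alternate (a b : ℝ) (d : ℕ → ℝ) (x y : ℝ) :
    IntervalIntegrable (fun s => alternate a b (count d s)) volume x y := by
  have hm : Measurable fun s => alternate a b (count d s) :=
    measurable_alternate_count a b measurable_const measurable_id
  rw [intervalIntegrable_iff]
  refine Measure.integrableOn_of_bounded (M := max |a| |b|) (by simp [Set.uIoc])
    hm.aestronglyMeasurable (.of_forall fun s => ?_)
  unfold alternate
  split_ifs <;> simp

lemma integral_alternate_of_le (a b : ℝ) {d : ℕ → ℝ} (hd : ∀ n, 0 < d n) {n : ℕ} {s : ℝ}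
    (h1 : epoch d n ≤ s) (h2 : s ≤ epoch d (n + 1)) :
    ∫ x in epoch d n..s, alternate a b (count d x) = alternate a b n * (s - epoch d n) := by
  rw [intervalIntegral.integral_of_le h1, integral_Ioc_eq_integral_Ioo,
    setIntegral_congr_fun (g := fun _ => alternate a b n) measurableSet_Ioo ?_]
  · simp [h1, mul_comm]
  · intro x hx
    simp only
    rw [count_eq_of_mem_stay hd (n := n) (t := x) ⟨hx.1.le, hx.2.trans_le h2⟩]

lemma travel_eq (a b : ℝ) {d : ℕ → ℝ} (hd : ∀ n, 0 < d n) {n : ℕ} {s : ℝ}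
    (h1 : epoch d n ≤ s) (h2 : s ≤ epoch d (n + 1)) :
    travel a b d s = travel a b d (epoch d n) + alternate a b n * (s - epoch d n) := by
  rw [← integral_alternate_of_le a b hd h1 h2, travel, travel,
    intervalIntegral.integral_add_adjacent_intervals] <;>
  exact intervalIntegrable_alternate ..

lemma travel_epoch_succ (a b : ℝ) {d : ℕ → ℝ} (hd : ∀ n, 0 < d n) (n : ℕ) :
    travel a b d (epoch d (n + 1)) = travel a b d (epoch d n) + alternate a b n * d n := by
  rw [travel_eq a b hd (n := n) (epoch_mono hd n.le_succ) le_rfl, epoch_succ]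
  ring

lemma travel_epoch_even (a b : ℝ) {p q : ℕ → ℝ} (hd : ∀ n, 0 < interleave p q n) (n : ℕ) :
    travel a b (interleave p q) (epoch (interleave p q) (2 * n)) =
      a * epoch p n + b * epoch q n := by
  induction n with
  | zero => simp [epoch_zero, travel]
  | succ n ih =>
    rw [show 2 * (n + 1) = 2 * n + 1 + 1 by ring, travel_epoch_succ a b hd,
      travel_epoch_succ a b hd, ih, interleave_even, interleave_odd, alternate_even,
      alternate_odd, epoch_succ, epoch_succ]
    ring

/-- After 2n changes exactly n durations with velocity b are complete, and all the remaining time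
was spent with velocity a. -/
lemma travel_of_mem_stay_even (a b : ℝ) {p q : ℕ → ℝ} (hd : ∀ n, 0 < interleave p q n) {n : ℕ}
    {s : ℝ} (h : interleave p q ∈ stay (2 * n) s) :
    travel a b (interleave p q) s = a * (s - epoch q n) + b * epoch q n := by
  rw [travel_eq a b hd h.1 h.2.le, travel_epoch_even a b hd, alternate_even,
    epoch_interleave_even]
  ring

lemma travel_of_mem_stay_odd (a b : ℝ) {p q : ℕ → ℝ} (hd : ∀ n, 0 < interleave p q n) {n : ℕ}
    {s : ℝ} (h : interleave p q ∈ stay (2 * n + 1) s) :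
    travel a b (interleave p q) s = a * epoch p (n + 1) + b * (s - epoch p (n + 1)) := by
  rw [travel_eq a b hd h.1 h.2.le, travel_epoch_succ a b hd, travel_epoch_even a b hd,
    alternate_even, alternate_odd, epoch_interleave_odd, interleave_even, epoch_succ]
  ring

/-- Subtracting the time spent in `q` turns a condition on the merged sequence into one on `p`
alone, given a single epoch of `q`. Independence of the two processes can then be used. -/
lemma interleave_mem_stay_even {p q : ℕ → ℝ} {n : ℕ} {s : ℝ} :
    interleave p q ∈ stay (2 * n) s ↔ p ∈ stay n (s - epoch q n) := by
  simp only [stay, Set.mem_ofPred_eq, epoch_interleave_even, epoch_interleave_odd]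
  constructor <;> rintro ⟨h1, h2⟩ <;> constructor <;> linarith

lemma interleave_mem_stay_odd {p q : ℕ → ℝ} {n : ℕ} {s : ℝ} :
    interleave p q ∈ stay (2 * n + 1) s ↔ q ∈ stay n (s - epoch p (n + 1)) := by
  simp only [stay, Set.mem_ofPred_eq, epoch_interleave_odd,
    show 2 * n + 1 + 1 = 2 * (n + 1) by ring, epoch_interleave_even]
  constructor <;> rintro ⟨h1, h2⟩ <;> constructor <;> linarith

/-! ### The law of the telegraph process without resets -/

lemma measure_eq_tsum_of_ae {α : Type*} [MeasurableSpace α] {μ : Measure α} {S : Set α}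
    {E : ℕ → Set α} (hE : ∀ n, MeasurableSet (E n)) (hS : ∀ᵐ x ∂μ, x ∈ S ↔ ∃ n, x ∈ E n)
    (hd : ∀ᵐ x ∂μ, ∀ m n, x ∈ E m → x ∈ E n → m = n) : μ S = ∑' n, μ (E n) := by
  have h1 : S =ᵐ[μ] ⋃ n, E n := by
    filter_upwards [hS] with x hx
    exact propext (hx.trans Set.mem_iUnion.symm)
  rw [measure_congr h1, measure_iUnion₀ _ fun n => (hE n).nullMeasurableSet]
  intro m n hmn
  refine measure_mono_null (fun x hx => ?_) (ae_iff.1 hd)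
  exact fun h => hmn (h m n hx.1 hx.2)

section Law

variable {lam : ℝ}

lemma ae_regular_prod (hlam : 0 < lam) :
    ∀ᵐ z ∂(geometricLaw lam).prod (geometricLaw lam), Regular z.1 ∧ Regular z.2 := by
  have := isProbabilityMeasure_geometricLaw hlam
  have h := ae_regular_geometricLaw hlam
  filter_upwards [Measure.quasiMeasurePreserving_fst.ae h, Measure.quasiMeasurePreserving_snd.ae h]
    with z h1 h2
  exact ⟨h1, h2⟩

lemma measurableSet_mem_stay {α : Type*} [MeasurableSpace α] (n : ℕ) {f : α → ℕ → ℝ}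
    {g : α → ℝ} (hf : Measurable f) (hg : Measurable g) :
    MeasurableSet {x | f x ∈ stay n (g x)} :=
  measurableSet_setOf_and (measurableSet_le ((measurable_epoch n).comp hf) hg)
    (measurableSet_lt hg ((measurable_epoch (n + 1)).comp hf))

/-- The law of the displacement at time `s` on the event that the current velocity is the
initial one. -/
lemma law_travel_even (hlam : 0 < lam) (a b : ℝ) {s : ℝ} (hs : 0 ≤ s) {B : Set ℝ}
    (hB : MeasurableSet B) :
    ((geometricLaw lam).prod (geometricLaw lam)) {z | travel a b (interleave z.1 z.2) s ∈ B ∧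
        Even (count (interleave z.1 z.2) s)} =
      ENNReal.ofReal (1 / (1 + lam * s)) * B.indicator (fun _ => 1) (a * s) +
        ∫⁻ y in Set.Ioc 0 s, ENNReal.ofReal (lam ^ 2 * (s - y) / (1 + lam * s) ^ 2) *
          B.indicator (fun _ => 1) (a * (s - y) + b * y) := by
  have := isProbabilityMeasure_geometricLaw hlam
  let E : ℕ → Set ((ℕ → ℝ) × (ℕ → ℝ)) := fun n =>
    {z | z.1 ∈ stay n (s - epoch z.2 n) ∧ a * (s - epoch z.2 n) + b * epoch z.2 n ∈ B}
  have hE : ∀ n, MeasurableSet (E n) := fun n =>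
    measurableSet_setOf_and (measurableSet_mem_stay n (by fun_prop) (by fun_prop))
      ((by fun_prop : Measurable fun z : (ℕ → ℝ) × (ℕ → ℝ) =>
        a * (s - epoch z.2 n) + b * epoch z.2 n) hB)
  rw [measure_eq_tsum_of_ae hE]
  rotate_left
  · filter_upwards [ae_regular_prod hlam] with z hz
    have hr := hz.1.interleave hz.2
    simp only [Set.mem_ofPred_eq, E]
    constructor
    · rintro ⟨h1, h2⟩
      obtain ⟨n, hn⟩ := h2.two_dvd
      have h3 := (hr.count_eq_iff hs).1 hn
      rw [travel_of_mem_stay_even a b hr.1 h3] at h1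
      exact ⟨n, interleave_mem_stay_even.1 h3, h1⟩
    · rintro ⟨n, h1, h2⟩
      have h3 := interleave_mem_stay_even.2 h1
      rw [travel_of_mem_stay_even a b hr.1 h3, count_eq_of_mem_stay hr.1 h3]
      exact ⟨h2, even_two_mul n⟩
  · filter_upwards [ae_regular_prod hlam] with z hz m n hm hn
    have hr := hz.1.interleave hz.2
    have := eq_of_mem_stay hr.1 (interleave_mem_stay_even.2 hm.1)
      (interleave_mem_stay_even.2 hn.1)
    omega
  let f : ℕ → ℝ → ℝ≥0∞ := fun n y => B.indicator (fun _ => 1) (a * (s - y) + b * y) *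
    (Set.Ici 0).indicator (fun z => ENNReal.ofReal (countProb lam n z)) (s - y)
  have hBm : Measurable (B.indicator fun _ => (1 : ℝ≥0∞)) := measurable_const.indicator hB
  have hcm : ∀ n, Measurable
      ((Set.Ici (0 : ℝ)).indicator fun z => ENNReal.ofReal (countProb lam n z)) :=
    fun n => Measurable.indicator (by fun_prop) measurableSet_Ici
  have hf : ∀ n, Measurable (f n) := fun n =>
    (hBm.comp (by fun_prop)).mul ((hcm n).comp (by fun_prop))
  have h1 : ∀ n, ((geometricLaw lam).prod (geometricLaw lam)) (E n) =
      ∫⁻ q, f n (epoch q n) ∂geometricLaw lam := by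
    intro n
    -- For fixed `q` the displacement is determined, so the section of `E n` is either a `stay`
    -- event for `p` or empty.
    rw [Measure.prod_apply_symm (hE n)]
    refine lintegral_congr fun q => ?_
    simp only [f]
    rw [← geometricLaw_stay hlam]
    by_cases h : a * (s - epoch q n) + b * epoch q n ∈ B
    · simp [E, h]
    · simp [E, h]
  simp_rw [h1]
  -- The term n = 0 is the absence of any change; it alone produces an atom.
  rw [tsum_eq_zero_add' ENNReal.summable]
  congr 1
  · simp [epoch_zero, f, hs, countProb, mul_comm]
  · simp_rw [fun n => lintegral_epoch_succ_geometricLaw hlam n (hf (n + 1))]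
    rw [← lintegral_tsum (fun n => by have := hf (n + 1); fun_prop), ← lintegral_indicator measurableSet_Ioi,
      ← lintegral_indicator measurableSet_Ioc]
    refine lintegral_congr fun y => ?_
    by_cases hy : 0 < y
    · rw [Set.indicator_of_mem (by exact hy)]
      simp_rw [f, mul_left_comm (ENNReal.ofReal _)]
      rw [ENNReal.tsum_mul_left]
      by_cases hys : y ≤ s
      · have hI : y ∈ Set.Ioc 0 s := ⟨hy, hys⟩
        rw [Set.indicator_of_mem hI, mul_comm]
        congr 1
        have h2 : s - y ∈ Set.Ici 0 := sub_nonneg.2 hys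
        simp_rw [Set.indicator_of_mem h2]
        rw [tsum_epochDensity_mul_countProb_succ hlam hy.le h2]
        ring_nf
      · simp [hys]
    · simp [hy]

/-- The law of the displacement at time `s` on the event that the current velocity is not the
initial one. -/
lemma law_travel_odd (hlam : 0 < lam) (a b : ℝ) {s : ℝ} (hs : 0 ≤ s) {B : Set ℝ}
    (hB : MeasurableSet B) :
    ((geometricLaw lam).prod (geometricLaw lam)) {z | travel a b (interleave z.1 z.2) s ∈ B ∧
        ¬ Even (count (interleave z.1 z.2) s)} =
      ∫⁻ x in Set.Ioc 0 s, ENNReal.ofReal (lam * (1 + lam * (s - x)) / (1 + lam * s) ^ 2) *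
          B.indicator (fun _ => 1) (a * x + b * (s - x)) := by
  have := isProbabilityMeasure_geometricLaw hlam
  let E : ℕ → Set ((ℕ → ℝ) × (ℕ → ℝ)) := fun n =>
    {z | z.2 ∈ stay n (s - epoch z.1 (n + 1)) ∧
      a * epoch z.1 (n + 1) + b * (s - epoch z.1 (n + 1)) ∈ B}
  have hE : ∀ n, MeasurableSet (E n) := fun n =>
    measurableSet_setOf_and (measurableSet_mem_stay n (by fun_prop) (by fun_prop))
      ((by fun_prop : Measurable fun z : (ℕ → ℝ) × (ℕ → ℝ) =>
        a * epoch z.1 (n + 1) + b * (s - epoch z.1 (n + 1))) hB)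
  rw [measure_eq_tsum_of_ae hE]
  rotate_left
  · filter_upwards [ae_regular_prod hlam] with z hz
    have hr := hz.1.interleave hz.2
    simp only [Set.mem_ofPred_eq, E]
    constructor
    · rintro ⟨h1, h2⟩
      obtain ⟨n, hn⟩ := Nat.not_even_iff_odd.1 h2
      have h3 := (hr.count_eq_iff hs).1 hn
      rw [travel_of_mem_stay_odd a b hr.1 h3] at h1
      exact ⟨n, interleave_mem_stay_odd.1 h3, h1⟩
    · rintro ⟨n, h1, h2⟩
      have h3 := interleave_mem_stay_odd.2 h1
      rw [travel_of_mem_stay_odd a b hr.1 h3, count_eq_of_mem_stay hr.1 h3]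
      exact ⟨h2, by simp⟩
  · filter_upwards [ae_regular_prod hlam] with z hz m n hm hn
    have hr := hz.1.interleave hz.2
    have := eq_of_mem_stay hr.1 (interleave_mem_stay_odd.2 hm.1)
      (interleave_mem_stay_odd.2 hn.1)
    omega
  let f : ℕ → ℝ → ℝ≥0∞ := fun n x => B.indicator (fun _ => 1) (a * x + b * (s - x)) *
    (Set.Ici 0).indicator (fun z => ENNReal.ofReal (countProb lam n z)) (s - x)
  have hBm : Measurable (B.indicator fun _ => (1 : ℝ≥0∞)) := measurable_const.indicator hB
  have hcm : ∀ n, Measurable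
      ((Set.Ici (0 : ℝ)).indicator fun z => ENNReal.ofReal (countProb lam n z)) :=
    fun n => Measurable.indicator (by fun_prop) measurableSet_Ici
  have hf : ∀ n, Measurable (f n) := fun n =>
    (hBm.comp (by fun_prop)).mul ((hcm n).comp (by fun_prop))
  have h1 : ∀ n, ((geometricLaw lam).prod (geometricLaw lam)) (E n) =
      ∫⁻ x in Set.Ioi 0, ENNReal.ofReal (epochDensity lam n x) * f n x := by
    intro n
    -- Here the epoch of the initial velocity's durations is fixed and the other process is counted.
    -- Its index n + 1 is positive, so no atom occurs.
    rw [Measure.prod_apply (hE n), ← lintegral_epoch_succ_geometricLaw hlam n (hf n)]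
    refine lintegral_congr fun p => ?_
    simp only [f]
    rw [← geometricLaw_stay hlam]
    by_cases h : a * epoch p (n + 1) + b * (s - epoch p (n + 1)) ∈ B
    · simp [E, h]
    · simp [E, h]
  simp_rw [h1]
  rw [← lintegral_tsum (fun n => by have := hf n; fun_prop), ← lintegral_indicator measurableSet_Ioi,
      ← lintegral_indicator measurableSet_Ioc]
  refine lintegral_congr fun x => ?_
  by_cases hx : 0 < x
  · rw [Set.indicator_of_mem (by exact hx)]
    simp_rw [f, mul_left_comm (ENNReal.ofReal _)]
    rw [ENNReal.tsum_mul_left]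
    by_cases hxs : x ≤ s
    · have hI : x ∈ Set.Ioc 0 s := ⟨hx, hxs⟩
      rw [Set.indicator_of_mem hI, mul_comm]
      congr 1
      have h2 : s - x ∈ Set.Ici 0 := sub_nonneg.2 hxs
      simp_rw [Set.indicator_of_mem h2]
      rw [tsum_epochDensity_mul_countProb hlam hx.le h2]
      ring_nf
    · simp [hxs]
  · simp [hx]

end Law

/-! ### From the time spent with one velocity to the density of the displacement -/

lemma lintegral_comp_affine {c : ℝ} (hc : c ≠ 0) (d : ℝ) {g : ℝ → ℝ≥0∞} (hg : Measurable g) :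
    ∫⁻ y, g (c * y + d) = ENNReal.ofReal |c|⁻¹ * ∫⁻ z, g z := by
  rw [← lintegral_add_right_eq_self g d, ← abs_inv, ← smul_eq_mul,
    ← lintegral_smul_measure, ← Real.map_volume_mul_left hc, lintegral_map (by fun_prop) (by fun_prop)]

/-- The time spent with velocity `b` if the displacement in `[0, s]` is `x`. -/
noncomputable def otherTime (a b x s : ℝ) : ℝ := (a * s - x) / (a - b)

/-- The displacement is an affine function, of slope b - a, of the time spent with velocity b, and
`otherTime` is its inverse. The endpoint s is dropped as a null set. -/
lemma setLIntegral_comp_mul_add {a b s : ℝ} (hab : a ≠ b) {B : Set ℝ} (hB : MeasurableSet B)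
    {F : ℝ → ℝ≥0∞} (hF : Measurable F) :
    ∫⁻ y in Set.Ioc 0 s, F y * B.indicator (fun _ => 1) (a * (s - y) + b * y) =
      ∫⁻ x in B, (Set.Ioo 0 s).indicator
        (fun y => ENNReal.ofReal |a - b|⁻¹ * F y) (otherTime a b x s) := by
  rw [setLIntegral_congr Ioo_ae_eq_Ioc.symm, ← lintegral_indicator measurableSet_Ioo,
    ← lintegral_indicator hB]
  have hab' : a - b ≠ 0 := sub_ne_zero.2 hab
  have hG : Measurable fun x => B.indicator
      (fun x => (Set.Ioo 0 s).indicator F (otherTime a b x s)) x := by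
    refine Measurable.indicator ?_ hB
    refine (hF.indicator measurableSet_Ioo).comp ?_
    unfold otherTime
    fun_prop
  have h := lintegral_comp_affine (c := b - a) (sub_ne_zero.2 hab.symm) (a * s) hG
  rw [abs_sub_comm] at h
  have h1 : ∀ x, B.indicator (fun x => (Set.Ioo 0 s).indicator
      (fun y => ENNReal.ofReal |a - b|⁻¹ * F y) (otherTime a b x s)) x =
      ENNReal.ofReal |a - b|⁻¹ *
        B.indicator (fun x => (Set.Ioo 0 s).indicator F (otherTime a b x s)) x := by
    intro x
    by_cases hx : x ∈ B <;> by_cases hy : otherTime a b x s ∈ Set.Ioo 0 s <;> simp [hx, hy]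
  simp_rw [h1]
  rw [lintegral_const_mul _ hG, ← h]
  refine lintegral_congr fun y => ?_
  have h2 : otherTime a b ((b - a) * y + a * s) s = y := by
    unfold otherTime
    field_simp
    ring
  have h3 : a * (s - y) + b * y = (b - a) * y + a * s := by ring
  by_cases hx : (b - a) * y + a * s ∈ B <;> by_cases hy : y ∈ Set.Ioo 0 s <;> simp [hx, hy, h2, h3]

/-- The absolutely continuous part of the law of the displacement at time `s` on the event that
the current velocity is the initial velocity `a`. -/
noncomputable def freeSame (a b lam x s : ℝ) : ℝ≥0∞ :=
  (Set.Ioo 0 s).indicator (fun y => ENNReal.ofReal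
    (lam ^ 2 * (s - y) / (|a - b| * (1 + lam * s) ^ 2))) (otherTime a b x s)

/-- The density of the displacement at time `s` on the event that the current velocity is `b`,
not the initial velocity `a`. -/
noncomputable def freeOther (a b lam x s : ℝ) : ℝ≥0∞ :=
  (Set.Ioo 0 s).indicator (fun y => ENNReal.ofReal
    (lam * (1 + lam * y) / (|a - b| * (1 + lam * s) ^ 2))) (otherTime a b x s)

lemma law_travel_same {a b lam : ℝ} (hlam : 0 < lam) (hab : a ≠ b) {s : ℝ} (hs : 0 ≤ s)
    {B : Set ℝ} (hB : MeasurableSet B) :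
    ((geometricLaw lam).prod (geometricLaw lam)) {z | travel a b (interleave z.1 z.2) s ∈ B ∧
        alternate a b (count (interleave z.1 z.2) s) = a} =
      ENNReal.ofReal (1 / (1 + lam * s)) * B.indicator (fun _ => 1) (a * s) +
        ∫⁻ x in B, freeSame a b lam x s := by
  have h1 : ∀ n, alternate a b n = a ↔ Even n := by
    intro n
    unfold alternate
    split_ifs with h <;> simp [h, hab.symm]
  simp_rw [h1]
  rw [law_travel_even hlam a b hs hB, setLIntegral_comp_mul_add hab hB (by fun_prop)]
  congr 1
  refine lintegral_congr fun x => ?_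
  unfold freeSame
  congr 1
  ext y
  rw [← ENNReal.ofReal_mul (by positivity)]
  congr 1
  rw [inv_mul_eq_div, div_div, mul_comm |a - b|]

lemma law_travel_other {a b lam : ℝ} (hlam : 0 < lam) (hab : a ≠ b) {s : ℝ} (hs : 0 ≤ s)
    {B : Set ℝ} (hB : MeasurableSet B) :
    ((geometricLaw lam).prod (geometricLaw lam)) {z | travel a b (interleave z.1 z.2) s ∈ B ∧
        alternate a b (count (interleave z.1 z.2) s) = b} =
      ∫⁻ x in B, freeOther a b lam x s := by
  have h1 : ∀ n, alternate a b n = b ↔ ¬ Even n := by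
    intro n
    unfold alternate
    split_ifs with h <;> simp [h, hab]
  simp_rw [h1]
  -- `law_travel_odd` integrates over the time spent with velocity a, so the change of variables is
  -- applied with the roles of a and b exchanged and then reflected by y ↦ s - y.
  have h2 : ∀ x, a * x + b * (s - x) = b * (s - x) + a * x := fun x => by ring
  simp_rw [law_travel_odd hlam a b hs hB, h2]
  rw [setLIntegral_comp_mul_add hab.symm hB
    (F := fun x => ENNReal.ofReal (lam * (1 + lam * (s - x)) / (1 + lam * s) ^ 2)) (by fun_prop)]
  refine lintegral_congr fun x => ?_
  have hab' : a - b ≠ 0 := sub_ne_zero.2 hab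
  have hba' : b - a ≠ 0 := sub_ne_zero.2 hab.symm
  have h3 : otherTime b a x s = s - otherTime a b x s := by
    unfold otherTime
    field_simp
    ring
  unfold freeOther
  rw [h3]
  generalize otherTime a b x s = y
  by_cases hy : y ∈ Set.Ioo 0 s
  · rw [Set.indicator_of_mem hy, Set.indicator_of_mem (by constructor <;> linarith [hy.1, hy.2]),
      ← ENNReal.ofReal_mul (by positivity), sub_sub_cancel, abs_sub_comm, inv_mul_eq_div, div_div,
      mul_comm |a - b|]
  · rw [Set.indicator_of_notMem hy, Set.indicator_of_notMem]
    rintro ⟨h4, h5⟩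
    exact hy ⟨by linarith, by linarith⟩

/-! ### Conditioning on the last reset -/

lemma map_driving {Ω : Type*} [MeasurableSpace Ω] {P : Measure Ω} [IsProbabilityMeasure P]
    {lam xi : ℝ} {R : Ω → ℕ → ℝ} {U W : ℕ → Ω → ℕ → ℝ} (h : IsDriving P lam xi R U W) (k : ℕ) :
    P.map (fun ω => (R ω, (U k ω, W k ω))) =
      (poissonLaw xi).prod ((geometricLaw lam).prod (geometricLaw lam)) := by
  have hR := h.resets.aemeasurable
  have hU := fun k => (h.durations₁ k).aemeasurable
  have hW := fun k => (h.durations₂ k).aemeasurable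
  have hm : ∀ i, AEMeasurable ((Sum.elim (fun _ : Unit => R) (Sum.elim U W)) i) P := by
    rintro (_ | k | k)
    · exact hR
    · exact hU k
    · exact hW k
  have h1 := h.indep.indepFun_prodMk₀ hm (.inr (.inl k)) (.inr (.inr k)) (.inl ()) (by simp)
    (by simp)
  have h2 := h.indep.indepFun (i := .inr (.inl k)) (j := .inr (.inr k)) (by simp)
  simp only [Sum.elim_inr, Sum.elim_inl] at h1 h2
  rw [(indepFun_iff_map_prod_eq_prod_map_map hR ((hU k).prodMk (hW k))).1 h1.symm,
    (indepFun_iff_map_prod_eq_prod_map_map (hU k) (hW k)).1 h2, h.resets.map_eq,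
    (h.durations₁ k).map_eq, (h.durations₂ k).map_eq]

/-- The index of the current cycle is a function of `R` alone. On the event that it equals k, the
durations `U k`, `W k` keep their law by independence, and summing over k leaves an integral over
the age. -/
lemma measure_reset {Ω : Type*} [MeasurableSpace Ω] {P : Measure Ω} [IsProbabilityMeasure P]
    {lam xi : ℝ} (hlam : 0 < lam) (hxi : 0 < xi) {R : Ω → ℕ → ℝ} {U W : ℕ → Ω → ℕ → ℝ}
    (h : IsDriving P lam xi R U W) {t : ℝ} (ht : 0 ≤ t)
    {T : Set (((ℕ → ℝ) × (ℕ → ℝ)) × ℝ)} (hT : MeasurableSet T) :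
    P {ω | ((U (count (R ω) t) ω, W (count (R ω) t) ω), age (R ω) t) ∈ T} =
      ENNReal.ofReal (Real.exp (-(xi * t))) *
          ((geometricLaw lam).prod (geometricLaw lam)) {z | (z, t) ∈ T} +
        ∫⁻ s in Set.Ioo 0 t, ENNReal.ofReal (xi * Real.exp (-(xi * s))) *
          ((geometricLaw lam).prod (geometricLaw lam)) {z | (z, s) ∈ T} := by
  have := isProbabilityMeasure_geometricLaw hlam
  have := isProbabilityMeasure_poissonLaw hxi
  let T' : ℕ → Set ((ℕ → ℝ) × ((ℕ → ℝ) × (ℕ → ℝ))) := fun k =>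
    {p | count p.1 t = k ∧ (p.2, t - epoch p.1 k) ∈ T}
  have hcount : Measurable fun d => count d t := by
    have h1 := measurable_count.comp (measurable_prodMk_right (y := t))
    exact h1
  have hT' : ∀ k, MeasurableSet (T' k) := fun k =>
    measurableSet_setOf_and ((hcount.comp measurable_fst) (measurableSet_singleton k))
      ((by fun_prop : Measurable fun p : (ℕ → ℝ) × ((ℕ → ℝ) × (ℕ → ℝ)) =>
        (p.2, t - epoch p.1 k)) hT)
  have hZ : ∀ k, AEMeasurable (fun ω => (R ω, (U k ω, W k ω))) P := fun k =>
    h.resets.aemeasurable.prodMk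
      ((h.durations₁ k).aemeasurable.prodMk (h.durations₂ k).aemeasurable)
  have hset : {ω | ((U (count (R ω) t) ω, W (count (R ω) t) ω), age (R ω) t) ∈ T} =
      ⋃ k, (fun ω => (R ω, (U k ω, W k ω))) ⁻¹' T' k := by
    ext ω
    simp [T', age]
  have hG : Measurable fun s : ℝ =>
      ((geometricLaw lam).prod (geometricLaw lam)) {z | (z, s) ∈ T} :=
    measurable_measure_prodMk_right hT
  rw [hset, measure_iUnion₀ _ fun k => (hZ k).nullMeasurableSet_preimage (hT' k),
    ← tsum_lintegral_age hxi ht hG]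
  · refine tsum_congr fun k => ?_
    have hk : MeasurableSet {d | count d t = k} := hcount (measurableSet_singleton k)
    rw [← Measure.map_apply_of_aemeasurable (hZ k) (hT' k), map_driving h,
      Measure.prod_apply (hT' k), ← lintegral_indicator hk]
    refine lintegral_congr fun d => ?_
    by_cases hd : count d t = k
    · rw [Set.indicator_of_mem (by exact hd)]
      simp [T', age, hd]
    · rw [Set.indicator_of_notMem (by exact hd)]
      simp [T', hd]
  · intro i j hij
    refine Disjoint.aedisjoint (Set.disjoint_left.2 fun ω hi hj => hij ?_)
    exact hi.1.symm.trans hj.1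

/-- The successive durations if the initial velocity is `v_j`. -/
noncomputable def durations (j : ℕ) (z : (ℕ → ℝ) × (ℕ → ℝ)) : ℕ → ℝ :=
  if j = 1 then interleave z.1 z.2 else interleave z.2 z.1

lemma measurable_durations (j : ℕ) : Measurable (durations j) := by
  unfold durations
  split_ifs
  · exact measurable_interleave
  · exact measurable_interleave.comp measurable_swap

/-- Both velocities have durations of the same law, so exchanging the two sequences preserves the
product measure and one computation serves both values of j. -/
lemma measure_durations {lam : ℝ} (hlam : 0 < lam) (j : ℕ) {p : (ℕ → ℝ) → Prop}
    (hp : MeasurableSet {d | p d}) :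
    ((geometricLaw lam).prod (geometricLaw lam)) {z | p (durations j z)} =
      ((geometricLaw lam).prod (geometricLaw lam)) {z | p (interleave z.1 z.2)} := by
  have := isProbabilityMeasure_geometricLaw hlam
  unfold durations
  split_ifs
  · rfl
  · have hm : MeasurableSet {z : (ℕ → ℝ) × (ℕ → ℝ) | p (interleave z.1 z.2)} :=
      measurable_interleave hp
    exact (Measure.measurePreserving_swap (μ := geometricLaw lam)
      (ν := geometricLaw lam)).measure_preimage hm.nullMeasurableSet

lemma velocity_eq {j : ℕ} (hj : j = 1 ∨ j = 2) (v₁ v₂ : ℝ) (u w : ℕ → ℝ) (s : ℝ) :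
    velocity v₁ v₂ j u w s =
      alternate (vel v₁ v₂ j) (vel v₁ v₂ (3 - j)) (count (durations j (u, w)) s) := by
  unfold velocity switches alternate durations
  rcases hj with rfl | rfl
  · simp only [vel]
    norm_num
    split_ifs with h
    · simp [h.neg_one_pow]
      ring
    · rw [(Nat.not_even_iff_odd.1 h).neg_one_pow]
      ring
  · simp only [vel]
    norm_num
    split_ifs with h
    · simp [h.neg_one_pow]
      ring
    · rw [(Nat.not_even_iff_odd.1 h).neg_one_pow]
      ring

lemma position_eq {j : ℕ} (hj : j = 1 ∨ j = 2) (v₁ v₂ : ℝ) (u w : ℕ → ℝ) (s : ℝ) :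
    position v₁ v₂ j u w s =
      travel (vel v₁ v₂ j) (vel v₁ v₂ (3 - j)) (durations j (u, w)) s := by
  simp_rw [position, velocity_eq hj, travel]

lemma measurableSet_travel_alternate {α : Type*} [MeasurableSpace α] (a b v : ℝ)
    {f : α → ℕ → ℝ} {g : α → ℝ} (hf : Measurable f) (hg : Measurable g) {B : Set ℝ}
    (hB : MeasurableSet B) :
    MeasurableSet {x | travel a b (f x) (g x) ∈ B ∧ alternate a b (count (f x) (g x)) = v} :=
  measurableSet_setOf_and (((measurable_travel a b).comp (hf.prodMk hg)) hB)
    ((measurable_alternate_count a b hf hg) (measurableSet_singleton v))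

/-- The law of the process with resets in terms of the law of the telegraph process. -/
lemma measure_resetPosition {Ω : Type*} [MeasurableSpace Ω] {P : Measure Ω}
    [IsProbabilityMeasure P] {lam xi : ℝ} (hlam : 0 < lam) (hxi : 0 < xi) {R : Ω → ℕ → ℝ}
    {U W : ℕ → Ω → ℕ → ℝ} (h : IsDriving P lam xi R U W) {j : ℕ} (hj : j = 1 ∨ j = 2)
    (v₁ v₂ : ℝ) {t : ℝ} (ht : 0 ≤ t) {B : Set ℝ} (hB : MeasurableSet B) (v : ℝ) {a b : ℝ}
    (ha : vel v₁ v₂ j = a) (hb : vel v₁ v₂ (3 - j) = b) {G : ℝ → ℝ≥0∞}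
    (hG : ∀ s, 0 ≤ s → ((geometricLaw lam).prod (geometricLaw lam))
      {z | travel a b (interleave z.1 z.2) s ∈ B ∧
        alternate a b (count (interleave z.1 z.2) s) = v} = G s) :
    P {ω | resetPosition v₁ v₂ j (R ω) (fun k => U k ω) (fun k => W k ω) t ∈ B ∧
        resetVelocity v₁ v₂ j (R ω) (fun k => U k ω) (fun k => W k ω) t = v} =
      ENNReal.ofReal (Real.exp (-(xi * t))) * G t +
        ∫⁻ s in Set.Ioo 0 t, ENNReal.ofReal (xi * Real.exp (-(xi * s))) * G s := by
  have h1 := measure_reset hlam hxi h ht (measurableSet_travel_alternate a b v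
    ((measurable_durations j).comp measurable_fst) measurable_snd hB)
  have h2 : ∀ s, 0 ≤ s → ((geometricLaw lam).prod (geometricLaw lam))
      {z | travel a b (durations j z) s ∈ B ∧
        alternate a b (count (durations j z) s) = v} = G s := by
    intro s hs
    rw [← hG s hs]
    exact measure_durations hlam j
      (p := fun d => travel a b d s ∈ B ∧ alternate a b (count d s) = v)
      (measurableSet_travel_alternate a b v measurable_id measurable_const hB)
  simp only [Set.mem_ofPred_eq, Function.comp] at h1
  rw [h2 t ht, setLIntegral_congr_fun (g := fun s =>
    ENNReal.ofReal (xi * Real.exp (-(xi * s))) * G s) measurableSet_Ioo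
    (fun s hs => by simp only [h2 s hs.1.le])] at h1
  simp only [resetPosition, resetVelocity, position_eq hj, velocity_eq hj, ha, hb]
  exact h1

/-! ### The integral over the time since the last reset -/

/-- The substitution u = ξ(s + 1/λ) gives 1 + λs = λu/ξ and e^{-ξs} = e^{ξ/λ} e^{-u}. -/
lemma integral_exp_div_eq_genGamma {lam xi lo hi : ℝ} (hlam : 0 < lam) (hxi : 0 < xi) :
    ∫ s in lo..hi, Real.exp (-(xi * s)) / (1 + lam * s) =
      Real.exp (xi / lam) / lam * genGamma 0 ((lo + 1 / lam) * xi) ((hi + 1 / lam) * xi) := by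
  have h := intervalIntegral.integral_comp_mul_add
    (fun u : ℝ => u ^ ((0 : ℝ) - 1) * Real.exp (-u)) hxi.ne' (xi / lam) (a := lo) (b := hi)
  have h1 : ∀ s, xi * s + xi / lam = (s + 1 / lam) * xi := fun s => by ring
  simp only [h1] at h
  unfold genGamma
  rw [eq_inv_smul_iff₀ hxi.ne', smul_eq_mul] at h
  rw [← h, ← intervalIntegral.integral_const_mul, ← intervalIntegral.integral_const_mul]
  refine intervalIntegral.integral_congr fun s _ => ?_
  simp only [zero_sub, Real.rpow_neg_one]
  have h2 : Real.exp (-(xi * s)) = Real.exp (xi / lam) * Real.exp (-((s + 1 / lam) * xi)) := by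
    rw [← Real.exp_add]
    ring_nf
  have h3 : (s + 1 / lam) * xi = (1 + lam * s) * (xi / lam) := by
    field_simp
    ring
  rw [h2, h3, mul_inv, inv_div]
  field_simp

lemma continuousOn_exp_mul_div_sq {lam xi lo hi : ℝ} (hlam : 0 < lam) (hlo : 0 ≤ lo) (C D : ℝ) :
    ContinuousOn (fun s => xi * Real.exp (-(xi * s)) * ((C + D * (1 + lam * s)) /
      (1 + lam * s) ^ 2)) (Set.Icc lo hi) := by
  have h : ∀ s ∈ Set.Icc lo hi, (1 + lam * s) ^ 2 ≠ 0 := fun s hs => by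
    have := hlo.trans hs.1
    positivity
  fun_prop (disch := assumption)

lemma integral_exp_mul_div_sq {lam xi lo hi : ℝ} (hlam : 0 < lam) (hxi : 0 < xi) (hlo : 0 ≤ lo)
    (hlohi : lo ≤ hi) (C D : ℝ) :
    ∫ s in lo..hi, xi * Real.exp (-(xi * s)) * ((C + D * (1 + lam * s)) / (1 + lam * s) ^ 2) =
      xi * (C / lam * (Real.exp (-xi * lo) / (1 + lam * lo) - Real.exp (-xi * hi) / (1 + lam * hi))
        + (D - C * xi / lam) * (Real.exp (xi / lam) / lam *
          genGamma 0 ((lo + 1 / lam) * xi) ((hi + 1 / lam) * xi))) := by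
  have hpos : ∀ s ∈ Set.uIcc lo hi, 1 + lam * s ≠ 0 := fun s hs => by
    rw [Set.uIcc_of_le hlohi] at hs
    have := hlo.trans hs.1
    positivity
  have hpos2 : ∀ s ∈ Set.uIcc lo hi, (1 + lam * s) ^ 2 ≠ 0 := fun s hs => pow_ne_zero _ (hpos s hs)
  rw [← integral_exp_div_eq_genGamma hlam hxi]
  have hc1 : IntervalIntegrable (fun s => Real.exp (-(xi * s)) / (1 + lam * s)) volume lo hi :=
    ContinuousOn.intervalIntegrable (by fun_prop (disch := assumption))
  -- `F` is the derivative of -e^{-ξs}/(λ(1+λs)). Eliminating the square from the integrand by means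
  -- of `F` leaves only e^{-ξs}/(1+λs).
  let F : ℝ → ℝ := fun s => xi / lam * (Real.exp (-(xi * s)) / (1 + lam * s)) +
    Real.exp (-(xi * s)) / (1 + lam * s) ^ 2
  have hF : IntervalIntegrable F volume lo hi :=
    ContinuousOn.intervalIntegrable (by fun_prop (disch := assumption))
  have hd : ∀ s ∈ Set.uIcc lo hi,
      HasDerivAt (fun s => -(Real.exp (-(xi * s)) / (1 + lam * s)) / lam) (F s) s := by
    intro s hs
    have h1 : HasDerivAt (fun s => Real.exp (-(xi * s))) (Real.exp (-(xi * s)) * -xi) s := by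
      have := ((hasDerivAt_id s).const_mul xi).neg.exp
      simpa using this
    have h2 : HasDerivAt (fun s => 1 + lam * s) lam s := by
      simpa using ((hasDerivAt_id s).const_mul lam).const_add 1
    refine ((h1.div h2 (hpos s hs)).neg.div_const lam).congr_deriv ?_
    have := hpos s hs
    simp only [F]
    field_simp
    ring
  have hint := intervalIntegral.integral_eq_sub_of_hasDerivAt hd hF
  have h3 : ∀ s ∈ Set.uIcc lo hi,
      xi * Real.exp (-(xi * s)) * ((C + D * (1 + lam * s)) / (1 + lam * s) ^ 2) =
      xi * C * F s + xi * (D - C * xi / lam) * (Real.exp (-(xi * s)) / (1 + lam * s)) := by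
    intro s hs
    have := hpos s hs
    simp only [F]
    field_simp
    ring
  rw [intervalIntegral.integral_congr h3, intervalIntegral.integral_add (hF.const_mul _)
    (hc1.const_mul _), intervalIntegral.integral_const_mul, intervalIntegral.integral_const_mul,
    hint]
  simp only [neg_mul]
  ring

/-- The positive times before `t` at which `x` lies strictly inside the range of the telegraph
process form an interval. -/
lemma exists_window {v₁ v₂ lam xi x t : ℝ} (hv : (v₂ < 0 ∧ 0 < v₁) ∨ (0 < v₂ ∧ v₂ < v₁))
    (ht : 0 < t) (hx : min (v₂ * t) 0 < x ∧ x < v₁ * t) :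
    ∃ lo hi, 0 ≤ lo ∧ lo ≤ hi ∧
      thetaFun v₁ v₂ lam xi x t =
        Real.exp (-xi * lo) / (1 + lam * lo) - Real.exp (-xi * hi) / (1 + lam * hi) ∧
      gammaFun v₁ v₂ lam xi x t = genGamma 0 ((lo + 1 / lam) * xi) ((hi + 1 / lam) * xi) ∧
      ∀ s, ((0 < s ∧ s < t) ∧ v₂ * s < x ∧ x < v₁ * s) ↔ lo < s ∧ s < hi := by
  rcases hv with ⟨h2, h1⟩ | ⟨h2, h12⟩
  -- The range (v₂s, v₁s) grows with s, so x enters it at time M_x and stays inside until t.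
  · have hm : 0 ≤ bigM v₁ v₂ x := by
      rcases le_or_gt 0 x with h | h
      · exact le_max_of_le_left (by positivity)
      · exact le_max_of_le_right (div_nonneg_of_nonpos h.le h2.le)
    rw [min_eq_left (by nlinarith)] at hx
    have hmt : bigM v₁ v₂ x < t := by
      refine max_lt ((div_lt_iff₀ h1).2 (by linarith)) ((div_lt_iff_of_neg h2).2 (by linarith))
    refine ⟨bigM v₁ v₂ x, t, hm, hmt.le, by simp [thetaFun, h2], by simp [gammaFun, h2], ?_⟩
    intro s
    have hs : bigM v₁ v₂ x < s ↔ v₂ * s < x ∧ x < v₁ * s := by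
      rw [bigM, max_lt_iff, div_lt_iff₀ h1, div_lt_iff_of_neg h2, mul_comm s, mul_comm s, and_comm]
    rw [← hs]
    constructor
    · rintro ⟨⟨-, h⟩, h'⟩
      exact ⟨h', h⟩
    · rintro ⟨h', h⟩
      exact ⟨⟨hm.trans_lt h', h⟩, h'⟩
  -- Both ends of the range move to the right: x enters at time x/v₁ and leaves at time x/v₂.
  · have h1 : 0 < v₁ := h2.trans h12
    rw [min_eq_right (by positivity)] at hx
    have hx0 := hx.1
    have h3 : x / v₁ ≤ smallM v₂ x t := by
      refine le_min (div_le_div_of_nonneg_left hx0.le h2 h12.le) ?_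
      rw [div_le_iff₀ h1]
      linarith
    refine ⟨x / v₁, smallM v₂ x t, by positivity, h3, by simp [thetaFun, h2.le.not_gt],
      by simp [gammaFun, h2.le.not_gt], ?_⟩
    intro s
    rw [smallM, lt_min_iff, lt_div_iff₀ h2, div_lt_iff₀ h1, mul_comm s, mul_comm s]
    constructor
    · rintro ⟨⟨-, h⟩, h', h''⟩
      exact ⟨h'', h', h⟩
    · rintro ⟨h'', h', h⟩
      exact ⟨⟨pos_of_mul_pos_right (hx0.trans h'') h1.le, h⟩, h', h''⟩

lemma not_window {v₁ v₂ x t s : ℝ} (hv : (v₂ < 0 ∧ 0 < v₁) ∨ (0 < v₂ ∧ v₂ < v₁))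
    (hx : ¬ (min (v₂ * t) 0 < x ∧ x < v₁ * t)) (hs : 0 < s ∧ s < t) :
    ¬ (v₂ * s < x ∧ x < v₁ * s) := by
  rintro ⟨h3, h4⟩
  refine hx ⟨?_, ?_⟩
  · rcases hv with ⟨h2, h1⟩ | ⟨h2, h12⟩
    · exact min_lt_of_left_lt (by nlinarith)
    · exact min_lt_of_right_lt (by nlinarith)
  · rcases hv with ⟨h2, h1⟩ | ⟨h2, h12⟩ <;> nlinarith

/-- Here x is fixed, so C and D may depend on it. Nonnegativity of the closed form is proved
alongside, because `ENNReal.ofReal` would hide a negative value. -/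
lemma lintegral_window {v₁ v₂ lam xi x t : ℝ} (hv : (v₂ < 0 ∧ 0 < v₁) ∨ (0 < v₂ ∧ v₂ < v₁))
    (hlam : 0 < lam) (hxi : 0 < xi) (ht : 0 < t) (C D : ℝ) {g : ℝ → ℝ≥0∞}
    (hg : ∀ s, 0 < s → v₂ * s < x → x < v₁ * s → 0 ≤ C + D * (1 + lam * s) ∧
      g s = ENNReal.ofReal ((C + D * (1 + lam * s)) / (1 + lam * s) ^ 2))
    (hg0 : ∀ s, 0 < s → ¬ (v₂ * s < x ∧ x < v₁ * s) → g s = 0) :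
    (∫⁻ s in Set.Ioo 0 t, ENNReal.ofReal (xi * Real.exp (-(xi * s))) * g s =
      ENNReal.ofReal (bigI v₁ v₂ x t * (xi * (C / lam * thetaFun v₁ v₂ lam xi x t +
        (D - C * xi / lam) * (Real.exp (xi / lam) / lam * gammaFun v₁ v₂ lam xi x t))))) ∧
    0 ≤ bigI v₁ v₂ x t * (xi * (C / lam * thetaFun v₁ v₂ lam xi x t +
        (D - C * xi / lam) * (Real.exp (xi / lam) / lam * gammaFun v₁ v₂ lam xi x t))) := by
  by_cases hx : min (v₂ * t) 0 < x ∧ x < v₁ * t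
  · obtain ⟨lo, hi, hlo, hlohi, hth, hga, hw⟩ := exists_window (lam := lam) (xi := xi) hv ht hx
    have hnn : ∀ s ∈ Set.Ioo lo hi,
        0 ≤ xi * Real.exp (-(xi * s)) * ((C + D * (1 + lam * s)) / (1 + lam * s) ^ 2) := by
      intro s hs
      obtain ⟨⟨h0, -⟩, h1, h2⟩ := (hw s).2 hs
      have := (hg s h0 h1 h2).1
      positivity
    rw [bigI, ind, if_pos hx, one_mul, hth, hga, ← integral_exp_mul_div_sq hlam hxi hlo hlohi,
      intervalIntegral.integral_of_le hlohi, integral_Ioc_eq_integral_Ioo,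
      ofReal_integral_eq_lintegral_ofReal]
    · refine ⟨?_, setIntegral_nonneg measurableSet_Ioo hnn⟩
      rw [← lintegral_indicator measurableSet_Ioo, ← lintegral_indicator measurableSet_Ioo]
      refine lintegral_congr fun s => ?_
      by_cases hs : s ∈ Set.Ioo lo hi
      · obtain ⟨h0, h1, h2⟩ := (hw s).2 hs
        rw [Set.indicator_of_mem hs, Set.indicator_of_mem (by exact h0), (hg s h0.1 h1 h2).2,
          ← ENNReal.ofReal_mul (by positivity)]
      · rw [Set.indicator_of_notMem hs]
        by_cases h0 : s ∈ Set.Ioo 0 t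
        · rw [Set.indicator_of_mem h0, hg0 s h0.1 fun h => hs ((hw s).1 ⟨h0, h⟩), mul_zero]
        · rw [Set.indicator_of_notMem h0]
    · exact (continuousOn_exp_mul_div_sq hlam hlo C D).integrableOn_Icc.mono_set
        Set.Ioo_subset_Icc_self
    · filter_upwards [ae_restrict_mem measurableSet_Ioo] with s hs using hnn s hs
  · rw [bigI, ind, if_neg hx]
    simp only [zero_mul, ENNReal.ofReal_zero, le_refl, and_true]
    rw [setLIntegral_congr_fun (g := fun _ => 0) measurableSet_Ioo]
    · simp
    · intro s hs
      simp only
      rw [hg0 s hs.1 (not_window hv hx hs), mul_zero]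

/-! ### The densities -/

lemma measurable_otherTime (a b : ℝ) : Measurable fun p : ℝ × ℝ => otherTime a b p.1 p.2 := by
  unfold otherTime
  fun_prop

lemma measurable_freeSame (a b lam : ℝ) :
    Measurable fun p : ℝ × ℝ => freeSame a b lam p.1 p.2 := by
  have hm := measurable_otherTime a b
  have hS : MeasurableSet {p : ℝ × ℝ | 0 < otherTime a b p.1 p.2 ∧ otherTime a b p.1 p.2 < p.2} :=
    measurableSet_setOf_and (measurableSet_lt (by fun_prop) hm) (measurableSet_lt hm (by fun_prop))
  have h : Measurable fun p : ℝ × ℝ => ENNReal.ofReal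
      (lam ^ 2 * (p.2 - otherTime a b p.1 p.2) / (|a - b| * (1 + lam * p.2) ^ 2)) := by fun_prop
  exact h.indicator hS

lemma measurable_freeOther (a b lam : ℝ) :
    Measurable fun p : ℝ × ℝ => freeOther a b lam p.1 p.2 := by
  have hm := measurable_otherTime a b
  have hS : MeasurableSet {p : ℝ × ℝ | 0 < otherTime a b p.1 p.2 ∧ otherTime a b p.1 p.2 < p.2} :=
    measurableSet_setOf_and (measurableSet_lt (by fun_prop) hm) (measurableSet_lt hm (by fun_prop))
  have h : Measurable fun p : ℝ × ℝ => ENNReal.ofReal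
      (lam * (1 + lam * otherTime a b p.1 p.2) / (|a - b| * (1 + lam * p.2) ^ 2)) := by fun_prop
  exact h.indicator hS

/-- The density of the displacement if the velocity `a` has not changed since the last reset, on
the event that there was a reset. -/
noncomputable def freeJump (a lam xi t x : ℝ) : ℝ≥0∞ :=
  (Set.Ioo 0 t).indicator
    (fun s => ENNReal.ofReal (xi * Real.exp (-(xi * s)) / (|a| * (1 + lam * s)))) (x / a)

lemma measurable_freeJump (a lam xi t : ℝ) : Measurable (freeJump a lam xi t) := by
  have h : Measurable ((Set.Ioo 0 t).indicator
    (fun s => ENNReal.ofReal (xi * Real.exp (-(xi * s)) / (|a| * (1 + lam * s))))) :=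
    Measurable.indicator (by fun_prop) measurableSet_Ioo
  exact h.comp (measurable_id.div_const a)

/-- The atom sits at as, which moves with the age s; the substitution x = as spreads it into a
density. This needs a ≠ 0. -/
lemma lintegral_freeJump {a lam xi t : ℝ} (ha : a ≠ 0) {B : Set ℝ} (hB : MeasurableSet B) :
    ∫⁻ s in Set.Ioo 0 t, ENNReal.ofReal (xi * Real.exp (-(xi * s)) / (1 + lam * s)) *
        B.indicator (fun _ => 1) (a * s) =
      ∫⁻ x in B, freeJump a lam xi t x := by
  let F : ℝ → ℝ≥0∞ := fun s => ENNReal.ofReal (xi * Real.exp (-(xi * s)) / (1 + lam * s))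
  have hF : Measurable ((Set.Ioo 0 t).indicator F) :=
    Measurable.indicator (by fun_prop) measurableSet_Ioo
  have hG : Measurable (B.indicator fun x => (Set.Ioo 0 t).indicator F (x / a)) :=
    (hF.comp (measurable_id.div_const a)).indicator hB
  have h := lintegral_comp_affine ha 0 hG
  rw [← lintegral_indicator measurableSet_Ioo, ← lintegral_indicator hB]
  rw [← lintegral_const_mul _ hG] at h
  refine Eq.trans (lintegral_congr fun s => ?_) (h.trans (lintegral_congr fun x => ?_))
  · rw [add_zero]
    have : a * s / a = s := by field_simp
    by_cases hx : a * s ∈ B <;> by_cases hs : s ∈ Set.Ioo 0 t <;> simp [hx, hs, this, F]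
  · by_cases hx : x ∈ B
    · rw [Set.indicator_of_mem hx, Set.indicator_of_mem hx, freeJump]
      by_cases hs : x / a ∈ Set.Ioo 0 t
      · rw [Set.indicator_of_mem hs, Set.indicator_of_mem hs, ← ENNReal.ofReal_mul (by positivity)]
        congr 1
        rw [inv_mul_eq_div, div_div, mul_comm |a|]
      · simp [hs]
    · simp [hx]

lemma lintegral_free {xi t : ℝ} {f : ℝ → ℝ → ℝ≥0∞}
    (hf : Measurable fun p : ℝ × ℝ => f p.1 p.2) (B : Set ℝ) :
    ∫⁻ s in Set.Ioo 0 t, ENNReal.ofReal (xi * Real.exp (-(xi * s))) * ∫⁻ x in B, f x s =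
      ∫⁻ x in B, ∫⁻ s in Set.Ioo 0 t, ENNReal.ofReal (xi * Real.exp (-(xi * s))) * f x s := by
  have h : ∀ s, ENNReal.ofReal (xi * Real.exp (-(xi * s))) * ∫⁻ x in B, f x s =
      ∫⁻ x in B, ENNReal.ofReal (xi * Real.exp (-(xi * s))) * f x s := fun s =>
    (lintegral_const_mul _ (hf.comp (measurable_prodMk_right (y := s)))).symm
  simp_rw [h]
  refine lintegral_lintegral_swap ?_
  have h2 : Measurable fun p : ℝ × ℝ => f p.2 p.1 := hf.comp measurable_swap
  exact ((by fun_prop : Measurable fun p : ℝ × ℝ =>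
    ENNReal.ofReal (xi * Real.exp (-(xi * p.1))) * f p.2 p.1)).aemeasurable

/-- The absolutely continuous part with resets, from the one without resets. -/
noncomputable def resetFree (xi t : ℝ) (f : ℝ → ℝ → ℝ≥0∞) (x : ℝ) : ℝ≥0∞ :=
  ENNReal.ofReal (Real.exp (-(xi * t))) * f x t +
    ∫⁻ s in Set.Ioo 0 t, ENNReal.ofReal (xi * Real.exp (-(xi * s))) * f x s

lemma measurable_resetFree (xi t : ℝ) {f : ℝ → ℝ → ℝ≥0∞}
    (hf : Measurable fun p : ℝ × ℝ => f p.1 p.2) : Measurable (resetFree xi t f) := by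
  have h1 : Measurable fun x => f x t := hf.comp (measurable_prodMk_right (y := t))
  have h2 : Measurable fun p : ℝ × ℝ => ENNReal.ofReal (xi * Real.exp (-(xi * p.2))) * f p.1 p.2 :=
    by fun_prop
  have h3 := h2.lintegral_prod_right' (ν := volume.restrict (Set.Ioo 0 t))
  exact (h1.const_mul _).add h3

lemma lintegral_resetFree {xi t : ℝ} {f : ℝ → ℝ → ℝ≥0∞}
    (hf : Measurable fun p : ℝ × ℝ => f p.1 p.2) (B : Set ℝ) :
    ENNReal.ofReal (Real.exp (-(xi * t))) * (∫⁻ x in B, f x t) +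
        ∫⁻ s in Set.Ioo 0 t, ENNReal.ofReal (xi * Real.exp (-(xi * s))) * ∫⁻ x in B, f x s =
      ∫⁻ x in B, resetFree xi t f x := by
  have h1 : Measurable fun x => f x t := hf.comp (measurable_prodMk_right (y := t))
  unfold resetFree
  rw [lintegral_free hf B, ← lintegral_const_mul _ h1,
    lintegral_add_left (h1.const_mul _)]

lemma lintegral_resetFree_add_freeJump {a b lam xi t : ℝ} (hxi : 0 < xi) (ha : a ≠ 0) {B : Set ℝ} (hB : MeasurableSet B) :
    ENNReal.ofReal (Real.exp (-(xi * t))) * (ENNReal.ofReal (1 / (1 + lam * t)) *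
        B.indicator (fun _ => 1) (a * t) + ∫⁻ x in B, freeSame a b lam x t) +
      ∫⁻ s in Set.Ioo 0 t, ENNReal.ofReal (xi * Real.exp (-(xi * s))) *
        (ENNReal.ofReal (1 / (1 + lam * s)) * B.indicator (fun _ => 1) (a * s) +
          ∫⁻ x in B, freeSame a b lam x s) =
      ENNReal.ofReal (Real.exp (-(xi * t)) / (1 + lam * t)) * B.indicator (fun _ => 1) (a * t) +
        ∫⁻ x in B, (freeJump a lam xi t x + resetFree xi t (freeSame a b lam) x) := by
  have hm := measurable_freeSame a b lam
  have hm' : Measurable fun s : ℝ => ∫⁻ x in B, freeSame a b lam x s :=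
    (hm.comp measurable_swap).lintegral_prod_right' (ν := volume.restrict B)
  rw [lintegral_add_left (measurable_freeJump a lam xi t), ← lintegral_freeJump ha hB,
    ← lintegral_resetFree hm B]
  simp_rw [mul_add]
  have hB1 : Measurable (B.indicator fun _ => (1 : ℝ≥0∞)) := measurable_const.indicator hB
  have hB2 : Measurable fun s => B.indicator (fun _ => (1 : ℝ≥0∞)) (a * s) :=
    hB1.comp (measurable_const_mul a)
  rw [lintegral_add_left (by fun_prop), ← mul_assoc, ← ENNReal.ofReal_mul (by positivity),
    mul_one_div]
  have h1 : ∫⁻ s in Set.Ioo 0 t, ENNReal.ofReal (xi * Real.exp (-(xi * s))) *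
      (ENNReal.ofReal (1 / (1 + lam * s)) * B.indicator (fun _ => 1) (a * s)) =
      ∫⁻ s in Set.Ioo 0 t, ENNReal.ofReal (xi * Real.exp (-(xi * s)) / (1 + lam * s)) *
        B.indicator (fun _ => 1) (a * s) := by
    refine lintegral_congr fun s => ?_
    rw [← mul_assoc, ← ENNReal.ofReal_mul (by positivity), mul_one_div]
  rw [h1]
  ring

/-- A sub-density given through extended nonnegative reals is integrable and gives the law. -/
lemma integrable_and_measureReal {Ω : Type*} [MeasurableSpace Ω] {P : Measure Ω}
    [IsProbabilityMeasure P] {S : Set ℝ → Set Ω} {c y : ℝ} (hc : 0 ≤ c) {f : ℝ → ℝ}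
    {F : ℝ → ℝ≥0∞} (hF : Measurable F) (hf : ∀ x, 0 ≤ f x ∧ F x = ENNReal.ofReal (f x))
    (hS : ∀ B, MeasurableSet B → P (S B) =
      ENNReal.ofReal c * B.indicator (fun _ => 1) y + ∫⁻ x in B, F x) :
    Integrable f ∧ ∀ B, MeasurableSet B →
      P.real (S B) = c * (Measure.dirac y).real B + ∫ x in B, f x := by
  have hfF : f = fun x => (F x).toReal := by
    ext x
    rw [(hf x).2, ENNReal.toReal_ofReal (hf x).1]
  -- For B the whole line, the integral of `F` is bounded by a probability.
  have hfin : ∫⁻ x, F x ≠ ∞ := by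
    have h := hS Set.univ .univ
    rw [setLIntegral_univ] at h
    exact ne_top_of_le_ne_top (measure_ne_top P (S Set.univ)) (h ▸ le_add_self)
  have hint : Integrable f := by
    rw [hfF]
    exact integrable_toReal_of_lintegral_ne_top hF.aemeasurable hfin
  refine ⟨hint, fun B hB => ?_⟩
  have h1 : ∫⁻ x in B, F x = ENNReal.ofReal (∫ x in B, f x) := by
    rw [ofReal_integral_eq_lintegral_ofReal hint.integrableOn (.of_forall fun x => (hf x).1)]
    simp_rw [(hf _).2]
  have h2 : 0 ≤ ∫ x in B, f x := integral_nonneg fun x => (hf x).1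
  rw [Measure.real, hS B hB, h1, Measure.real, Measure.dirac_apply' _ hB, ENNReal.toReal_add,
    ENNReal.toReal_mul, ENNReal.toReal_ofReal hc, ENNReal.toReal_ofReal h2]
  · rfl
  · refine ENNReal.mul_ne_top ENNReal.ofReal_ne_top ?_
    by_cases h : y ∈ B <;> simp [h]
  · exact ENNReal.ofReal_ne_top

/-! ### Pointwise identification of the densities with the closed forms -/

section Pointwise

variable {v₁ v₂ a b lam xi x t : ℝ}

lemma otherTime_mem (h12 : v₂ < v₁) (hab : (a = v₁ ∧ b = v₂) ∨ (a = v₂ ∧ b = v₁)) (s : ℝ) :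
    otherTime a b x s ∈ Set.Ioo 0 s ↔ v₂ * s < x ∧ x < v₁ * s := by
  have h : 0 < v₁ - v₂ := sub_pos.2 h12
  rcases hab with ⟨rfl, rfl⟩ | ⟨rfl, rfl⟩
  · rw [otherTime, Set.mem_Ioo, div_pos_iff_of_pos_right h, div_lt_iff₀ h]
    constructor <;> rintro ⟨h1, h2⟩ <;> constructor <;> linarith
  · have h3 : (a * s - x) / (a - b) = (x - a * s) / (b - a) := by
      rw [← neg_sub x, ← neg_sub b, neg_div_neg_eq]
    rw [otherTime, h3, Set.mem_Ioo, div_pos_iff_of_pos_right h, div_lt_iff₀ h]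
    constructor <;> rintro ⟨h1, h2⟩ <;> constructor <;> linarith

lemma freeJump_eq (hlam : 0 < lam) (hxi : 0 < xi) (ha : a ≠ 0) :
    0 ≤ Real.sign a * ind (0 < x / a ∧ x / a < t) *
      (xi * Real.exp (-xi * (x / a)) / (a + lam * x)) ∧
    freeJump a lam xi t x = ENNReal.ofReal (Real.sign a * ind (0 < x / a ∧ x / a < t) *
      (xi * Real.exp (-xi * (x / a)) / (a + lam * x))) := by
  by_cases h : 0 < x / a ∧ x / a < t
  -- Since a + λx = a(1 + λx/a), the sign of a turns the denominator a into |a|.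
  · have h1 : Real.sign a * ind (0 < x / a ∧ x / a < t) *
        (xi * Real.exp (-xi * (x / a)) / (a + lam * x)) =
        xi * Real.exp (-(xi * (x / a))) / (|a| * (1 + lam * (x / a))) := by
      have h0 := h.1
      have h2 : 1 + lam * (x / a) ≠ 0 := by positivity
      have h3 : a + lam * x = a * (1 + lam * (x / a)) := by field_simp
      rw [ind, if_pos h, h3, neg_mul]
      rcases lt_or_gt_of_ne ha with h4 | h4
      · rw [Real.sign_of_neg h4, abs_of_neg h4, neg_mul a, div_neg]
        ring
      · rw [Real.sign_of_pos h4, abs_of_pos h4]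
        ring
    have h0 := h.1
    rw [h1, freeJump, Set.indicator_of_mem (by exact h)]
    exact ⟨by positivity, rfl⟩
  · rw [ind, if_neg h, freeJump, Set.indicator_of_notMem (by exact h)]
    simp

end Pointwise

section Pointwise

variable {v₁ v₂ a b lam xi x t : ℝ}

lemma resetFree_eq (hv : (v₂ < 0 ∧ 0 < v₁) ∨ (0 < v₂ ∧ v₂ < v₁)) (hlam : 0 < lam) (hxi : 0 < xi)
    (ht : 0 < t) (C D : ℝ) {f : ℝ → ℝ → ℝ≥0∞}
    (hf : ∀ s, 0 < s → v₂ * s < x → x < v₁ * s → 0 ≤ C + D * (1 + lam * s) ∧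
      f x s = ENNReal.ofReal ((C + D * (1 + lam * s)) / (1 + lam * s) ^ 2))
    (hf0 : ∀ s, 0 < s → ¬ (v₂ * s < x ∧ x < v₁ * s) → f x s = 0) {A : ℝ}
    (hA : A = ind (v₂ * t < x ∧ x < v₁ * t) *
      (Real.exp (-(xi * t)) * ((C + D * (1 + lam * t)) / (1 + lam * t) ^ 2)) +
      bigI v₁ v₂ x t * (xi * (C / lam * thetaFun v₁ v₂ lam xi x t +
        (D - C * xi / lam) * (Real.exp (xi / lam) / lam * gammaFun v₁ v₂ lam xi x t)))) :
    0 ≤ A ∧ resetFree xi t f x = ENNReal.ofReal A := by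
  obtain ⟨h1, h2⟩ := lintegral_window (g := f x) hv hlam hxi ht C D hf hf0
  have h3 : 0 ≤ ind (v₂ * t < x ∧ x < v₁ * t) *
      (Real.exp (-(xi * t)) * ((C + D * (1 + lam * t)) / (1 + lam * t) ^ 2)) ∧
      ENNReal.ofReal (Real.exp (-(xi * t))) * f x t =
      ENNReal.ofReal (ind (v₂ * t < x ∧ x < v₁ * t) *
        (Real.exp (-(xi * t)) * ((C + D * (1 + lam * t)) / (1 + lam * t) ^ 2))) := by
    by_cases h : v₂ * t < x ∧ x < v₁ * t
    · obtain ⟨h4, h5⟩ := hf t ht h.1 h.2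
      rw [ind, if_pos h, one_mul, h5, ← ENNReal.ofReal_mul (by positivity)]
      exact ⟨by positivity, rfl⟩
    · rw [ind, if_neg h, hf0 t ht h]
      simp
  rw [hA, resetFree, h1, h3.2, ← ENNReal.ofReal_add h3.1 h2]
  exact ⟨add_nonneg h3.1 h2, rfl⟩

/-- C and D come from s - `otherTime` = (x - bs)/(a - b) and λ²(x - bs) = λ(λx + b) - λb(1 + λs). -/
lemma freeSame_eq (hlam : 0 < lam) (h12 : v₂ < v₁)
    (hab : (a = v₁ ∧ b = v₂) ∨ (a = v₂ ∧ b = v₁)) {s : ℝ} (h1 : v₂ * s < x)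
    (h2 : x < v₁ * s) {C D : ℝ} (hC : C = lam * (lam * x + b) / ((a - b) * |a - b|))
    (hD : D = -(lam * b) / ((a - b) * |a - b|)) :
    0 ≤ C + D * (1 + lam * s) ∧ freeSame a b lam x s =
      ENNReal.ofReal ((C + D * (1 + lam * s)) / (1 + lam * s) ^ 2) := by
  have hne : a - b ≠ 0 := by
    rcases hab with ⟨rfl, rfl⟩ | ⟨rfl, rfl⟩ <;> intro h <;> linarith
  have hm := (otherTime_mem h12 hab s).2 ⟨h1, h2⟩
  have hne' : |a - b| ≠ 0 := abs_ne_zero.2 hne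
  have h3 : C + D * (1 + lam * s) = lam ^ 2 * (s - otherTime a b x s) / |a - b| := by
    rw [hC, hD, otherTime]
    field_simp
    ring
  rw [h3, freeSame, Set.indicator_of_mem hm, div_div]
  have := sub_nonneg.2 hm.2.le
  exact ⟨by positivity, rfl⟩

/-- C and D come from (a - b) + λ(as - x) = a(1 + λs) - (λx + b). -/
lemma freeOther_eq (hlam : 0 < lam) (h12 : v₂ < v₁)
    (hab : (a = v₁ ∧ b = v₂) ∨ (a = v₂ ∧ b = v₁)) {s : ℝ} (h1 : v₂ * s < x)
    (h2 : x < v₁ * s) {C D : ℝ} (hC : C = -(lam * (lam * x + b)) / ((a - b) * |a - b|))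
    (hD : D = lam * a / ((a - b) * |a - b|)) :
    0 ≤ C + D * (1 + lam * s) ∧ freeOther a b lam x s =
      ENNReal.ofReal ((C + D * (1 + lam * s)) / (1 + lam * s) ^ 2) := by
  have hne : a - b ≠ 0 := by
    rcases hab with ⟨rfl, rfl⟩ | ⟨rfl, rfl⟩ <;> intro h <;> linarith
  have hm := (otherTime_mem h12 hab s).2 ⟨h1, h2⟩
  have hne' : |a - b| ≠ 0 := abs_ne_zero.2 hne
  have h3 : C + D * (1 + lam * s) = lam * (1 + lam * otherTime a b x s) / |a - b| := by
    rw [hC, hD, otherTime]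
    field_simp
    ring
  rw [h3, freeOther, Set.indicator_of_mem hm, div_div]
  have := hm.1.le
  exact ⟨by positivity, rfl⟩

lemma vel_cases {j : ℕ} (hj : j = 1 ∨ j = 2) :
    (vel v₁ v₂ j = v₁ ∧ vel v₁ v₂ (3 - j) = v₂) ∨ (vel v₁ v₂ j = v₂ ∧ vel v₁ v₂ (3 - j) = v₁) := by
  rcases hj with rfl | rfl <;> simp [vel]

lemma densitySame_eq (hv : (v₂ < 0 ∧ 0 < v₁) ∨ (0 < v₂ ∧ v₂ < v₁)) (hlam : 0 < lam)
    (hxi : 0 < xi) {j : ℕ} (hj : j = 1 ∨ j = 2) (ht : 0 < t) (ha : vel v₁ v₂ j = a)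
    (hb : vel v₁ v₂ (3 - j) = b) :
    0 ≤ densitySame v₁ v₂ lam xi j x t ∧
      freeJump a lam xi t x + resetFree xi t (freeSame a b lam) x =
        ENNReal.ofReal (densitySame v₁ v₂ lam xi j x t) := by
  have h12 : v₂ < v₁ := by rcases hv with ⟨h2, h1⟩ | ⟨h2, h1⟩ <;> linarith
  have hab : (a = v₁ ∧ b = v₂) ∨ (a = v₂ ∧ b = v₁) := ha ▸ hb ▸ vel_cases hj
  have ha0 : a ≠ 0 := by
    rcases hab with ⟨rfl, -⟩ | ⟨rfl, -⟩ <;> rcases hv with ⟨h2, h1⟩ | ⟨h2, h1⟩ <;> intro h <;>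
      linarith
  obtain ⟨h1, h2⟩ := freeJump_eq (x := x) (t := t) hlam hxi ha0
  obtain ⟨h3, h4⟩ := resetFree_eq (f := freeSame a b lam) (x := x) hv hlam hxi ht _ _
    (fun s _ hs1 hs2 => freeSame_eq hlam h12 hab hs1 hs2 rfl rfl)
    (fun s _ h => Set.indicator_of_notMem (mt (otherTime_mem h12 hab s).1 h) _) rfl
  rw [h2, h4, ← ENNReal.ofReal_add h1 h3]
  have hd : 0 < v₁ - v₂ := sub_pos.2 h12
  have hw : 1 + lam * t ≠ 0 := by positivity
  suffices h : _ = densitySame v₁ v₂ lam xi j x t from ⟨h ▸ add_nonneg h1 h3, congrArg _ h⟩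
  unfold densitySame tau
  rw [ha, hb, neg_mul xi t, add_right_comm, add_left_comm, add_assoc]
  -- With the transcendental terms and indicators made opaque, a rational identity remains for each
  -- j. The signs (-1)^j arise from (a - b)|a - b| = ±(v₁ - v₂)².
  generalize Real.sign a * _ * _ = J
  generalize thetaFun v₁ v₂ lam xi x t = θ
  generalize gammaFun v₁ v₂ lam xi x t = γ
  generalize bigI v₁ v₂ x t = I
  generalize Real.exp (xi / lam) = E
  generalize Real.exp (-(xi * t)) = e
  generalize ind (v₂ * t < x ∧ x < v₁ * t) = K
  rcases hj with rfl | rfl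
  · obtain rfl : v₁ = a := by simpa [vel] using ha
    obtain rfl : v₂ = b := by simpa [vel] using hb
    rw [abs_of_pos hd]
    simp only [Nat.reduceSub, pow_zero, pow_one, mul_one]
    field_simp
    ring
  · obtain rfl : v₂ = a := by simpa [vel] using ha
    obtain rfl : v₁ = b := by simpa [vel] using hb
    rw [abs_sub_comm, abs_of_pos hd, ← neg_sub v₁ v₂]
    simp only [Nat.reduceSub, pow_zero, pow_one, mul_one]
    field_simp
    ring

lemma densityOther_eq (hv : (v₂ < 0 ∧ 0 < v₁) ∨ (0 < v₂ ∧ v₂ < v₁)) (hlam : 0 < lam)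
    (hxi : 0 < xi) {j : ℕ} (hj : j = 1 ∨ j = 2) (ht : 0 < t) (ha : vel v₁ v₂ j = a)
    (hb : vel v₁ v₂ (3 - j) = b) :
    0 ≤ densityOther v₁ v₂ lam xi j x t ∧
      resetFree xi t (freeOther a b lam) x =
        ENNReal.ofReal (densityOther v₁ v₂ lam xi j x t) := by
  have h12 : v₂ < v₁ := by rcases hv with ⟨h2, h1⟩ | ⟨h2, h1⟩ <;> linarith
  have hab : (a = v₁ ∧ b = v₂) ∨ (a = v₂ ∧ b = v₁) := ha ▸ hb ▸ vel_cases hj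
  have hd : 0 < v₁ - v₂ := sub_pos.2 h12
  have hw : 1 + lam * t ≠ 0 := by positivity
  refine resetFree_eq (f := freeOther a b lam) (x := x) hv hlam hxi ht _ _
    (fun s _ hs1 hs2 => freeOther_eq hlam h12 hab hs1 hs2 rfl rfl)
    (fun s _ h => Set.indicator_of_notMem (mt (otherTime_mem h12 hab s).1 h) _) ?_
  unfold densityOther tau
  rw [ha, hb, neg_mul xi t]
  generalize thetaFun v₁ v₂ lam xi x t = θ
  generalize gammaFun v₁ v₂ lam xi x t = γ
  generalize bigI v₁ v₂ x t = I
  generalize Real.exp (xi / lam) = E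
  generalize Real.exp (-(xi * t)) = e
  generalize ind (v₂ * t < x ∧ x < v₁ * t) = K
  rcases hj with rfl | rfl
  · obtain rfl : v₁ = a := by simpa [vel] using ha
    obtain rfl : v₂ = b := by simpa [vel] using hb
    rw [abs_of_pos hd]
    simp only [Nat.reduceSub, pow_zero, pow_one, mul_one]
    field_simp
    ring
  · obtain rfl : v₂ = a := by simpa [vel] using ha
    obtain rfl : v₁ = b := by simpa [vel] using hb
    rw [abs_sub_comm, abs_of_pos hd, ← neg_sub v₁ v₂]
    simp only [Nat.reduceSub, pow_zero, pow_one, mul_one]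
    field_simp
    ring

end Pointwise

end ResetTelegraph

/-! ### The sub-densities of the process with resets -/

open ResetTelegraph

theorem mainTheorem1 {Ω : Type*} [MeasurableSpace Ω] (P : Measure Ω) [IsProbabilityMeasure P]
    (v₁ v₂ lam xi : ℝ) (hv : (v₂ < 0 ∧ 0 < v₁) ∨ (0 < v₂ ∧ v₂ < v₁))
    (hlam : 0 < lam) (hxi : 0 < xi)
    (R : Ω → ℕ → ℝ) (U W : ℕ → Ω → ℕ → ℝ) (hdrive : ResetTelegraph.IsDriving P lam xi R U W)
    (j : ℕ) (hj : j = 1 ∨ j = 2) (t : ℝ) (ht : 0 < t) :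
    -- the law of the position on the event that the velocity at time t is v_j
    (Integrable (fun x => ResetTelegraph.densitySame v₁ v₂ lam xi j x t) ∧
      ∀ B : Set ℝ, MeasurableSet B →
        P.real {ω |
            ResetTelegraph.resetPosition v₁ v₂ j (R ω) (fun k => U k ω) (fun k => W k ω) t ∈ B ∧
            ResetTelegraph.resetVelocity v₁ v₂ j (R ω) (fun k => U k ω) (fun k => W k ω) t
              = ResetTelegraph.vel v₁ v₂ j} =
          Real.exp (-xi * t) / (1 + lam * t)
              * (Measure.dirac (ResetTelegraph.vel v₁ v₂ j * t)).real B
            + ∫ x in B, ResetTelegraph.densitySame v₁ v₂ lam xi j x t) ∧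
    -- the law of the position on the event that the velocity at time t is the other one
    (Integrable (fun x => ResetTelegraph.densityOther v₁ v₂ lam xi j x t) ∧
      ∀ B : Set ℝ, MeasurableSet B →
        P.real {ω |
            ResetTelegraph.resetPosition v₁ v₂ j (R ω) (fun k => U k ω) (fun k => W k ω) t ∈ B ∧
            ResetTelegraph.resetVelocity v₁ v₂ j (R ω) (fun k => U k ω) (fun k => W k ω) t
              = ResetTelegraph.vel v₁ v₂ (3 - j)} =
          ∫ x in B, ResetTelegraph.densityOther v₁ v₂ lam xi j x t) := by
  -- Distinct velocities let the velocity reveal the parity of the number of changes; v_j ≠ 0 is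
  -- needed to spread the moving atom.
  have hv' : vel v₁ v₂ j ≠ vel v₁ v₂ (3 - j) ∧ vel v₁ v₂ j ≠ 0 := by
    rcases vel_cases (v₁ := v₁) (v₂ := v₂) hj with ⟨h1, h2⟩ | ⟨h1, h2⟩ <;> rw [h1, h2] <;>
      rcases hv with ⟨h3, h4⟩ | ⟨h3, h4⟩ <;> constructor <;> intro h <;> linarith
  constructor
  · refine integrable_and_measureReal (by positivity)
      ((measurable_freeJump _ lam xi t).add (measurable_resetFree xi t (measurable_freeSame _ _ lam)))
      (fun x => densitySame_eq hv hlam hxi hj ht rfl rfl) fun B hB => ?_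
    rw [measure_resetPosition hlam hxi hdrive hj v₁ v₂ ht.le hB _ rfl rfl
      (fun s hs => law_travel_same hlam hv'.1 hs hB),
      lintegral_resetFree_add_freeJump hxi hv'.2 hB, neg_mul]
    rfl
  -- There is no atom in this case: its mass is taken to be 0, and its location 0 is arbitrary.
  · have h := integrable_and_measureReal (y := 0) le_rfl
      (measurable_resetFree xi t (measurable_freeOther (vel v₁ v₂ j) (vel v₁ v₂ (3 - j)) lam))
      (fun x => densityOther_eq hv hlam hxi hj ht rfl rfl)
      (S := fun B => {ω | resetPosition v₁ v₂ j (R ω) (fun k => U k ω) (fun k => W k ω) t ∈ B ∧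
        resetVelocity v₁ v₂ j (R ω) (fun k => U k ω) (fun k => W k ω) t = vel v₁ v₂ (3 - j)})
      (P := P) fun B hB => ?_
    · simpa only [zero_mul, zero_add] using h
    · rw [measure_resetPosition hlam hxi hdrive hj v₁ v₂ ht.le hB _ rfl rfl
        (fun s hs => law_travel_other hlam hv'.1 hs hB),
        lintegral_resetFree (measurable_freeOther _ _ lam)]
      simp
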